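/- Let $m\ge 1$ and let $\mathbb D^m$ be the open unit polydisc in $\mathbb C^m$. Let $K:\mathbb D^m\times\mathbb D^m\to\mathbb C$ be a positive definite kernel, holomorphic in the first and anti-holomorphic in the second variable, with $K(w,w)\neq 0$ for all $w\in\mathbb D^m$. Let $\mathcal H_K$ be the Hilbert space with reproducing kernel $K$. Assume that the multiplications $M_i$ by the coordinate functions $z_i$ are bounded on $\mathcal H_K$ and that the tuple $\boldsymbol M^*=(M_1^*,\dots,M_m^*)$ of their adjoints belongs to the Cowen–Douglas class $B_1(\mathbb D^m)$. A commuting tuple $\boldsymbol T$ of bounded operators on a Hilbert space $\mathcal H$ is in $B_1(\mathbb D^m)$ if for each $w\in\mathbb D^m$ the operator $x\mapsto((T_1-w_1)x,\dots,(T_m-w_m)x)$ has closed range and one-dimensional kernel, and these kernels together span a dense subspace of $\mathcal H$. Let $S(z,w)=\prod_{i=1}^m(1-z_i\bar w_i)^{-1}$ be the Szegő kernel and let $\boldsymbol S_m$ be the tuple of multiplications by the coordinate functions on the Hardy space $H^2(\mathbb D^m)$. For $\boldsymbol T\in B_1(\mathbb D^m)$ let $$\mathsf K_{\boldsymbol T}(w)=\Big(-\frac{\partial^2}{\partial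 w_i\,\partial\bar w_j}\log\|\gamma(w)\|^2\Big)_{i,j=1}^m$$ be its curvature matrix, where $\gamma$ is any local non-vanishing holomorphic section of the line bundle with fibres $\bigcap_i\ker(T_i-w_i)$. A matrix-valued function $G$ on $\mathbb D^m$ is called a *positive definite function* if there is a matrix-valued function $\widetilde G(z,w)$ on $\mathbb D^m\times\mathbb D^m$, holomorphic in $z$ and anti-holomorphic in $w$, with $\widetilde G(w,w)=G(w)$, which is a positive definite kernel, that is, for all $u_1,\dots,u_n\in\mathbb D^m$ the block matrix $\big(\widetilde G(u_a,u_b)\big)_{a,b=1}^n$ is Hermitian and nonnegative. Write $G_1\preceq G_2$ if $G_2-G_1$ is a positive definite function. The tuple $\boldsymbol M$ is called an *infinitely divisible $m$-tuple of contractions* if $\|M_i\|\le 1$ for all $i$ and $(S^{-1}K)^t$ is a positive definite kernel on $\mathbb D^m$ for every $t>0$; here $(S^{-1}K)^t=\exp(tL)$, where $L$ is a logarithm of $S^{-1}K$ on $\mathbb D^m\times\mathbb D^m$ (required to exist) that is holomorphic in the first variable, anti-holomorphic in the second and real on the diagonal. Then the following are equivalent: 1. the function $\Big(\dfrac{\partial^2}{\partial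 w_i\,\partial\bar w_j}\log\big(S(w,w)^{-1}K(w,w)\big)\Big)_{i,j=1}^m$ is a positive definite function on $\mathbb D^m$; 2. $\mathsf K_{\boldsymbol M^*}(w)\preceq\mathsf K_{\boldsymbol S_m^*}(w)$, $w\in\mathbb D^m$; 3. $\boldsymbol M$ is an infinitely divisible $m$-tuple of contractions. -/

import Mathlib

open scoped ComplexOrder

noncomputable section

namespace CowenDouglas

/-- The open unit polydisc in `ℂ^m`. -/
def polydisc (m : ℕ) : Set (Fin m → ℂ) := {z | ∀ i, ‖z i‖ < 1}

/-- The Szegő kernel `∏ i, (1 - z_i conj w_i)⁻¹` of the polydisc. -/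
def szegoKernel {m : ℕ} (z w : Fin m → ℂ) : ℂ := ∏ i, (1 - z i * star (w i))⁻¹

/-! ### Kernels -/

/-- `F z w` is holomorphic in `z` and anti-holomorphic in `w`, for `z, w ∈ Ω`: the function
`(z, v) ↦ F z (conj v)` is holomorphic on `Ω × conj Ω`. -/
def IsSesquiholomorphicOn {m : ℕ} (Ω : Set (Fin m → ℂ))
    (F : (Fin m → ℂ) → (Fin m → ℂ) → ℂ) : Prop :=
  DifferentiableOn ℂ (fun p : (Fin m → ℂ) × (Fin m → ℂ) => F p.1 (star p.2))
    {p | p.1 ∈ Ω ∧ star p.2 ∈ Ω}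

/-- A scalar kernel `F` is positive definite on `Ω`: every matrix `(F (u a) (u b))` built from
finitely many points of `Ω` is Hermitian and nonnegative. -/
def IsPosDefKernelOn {m : ℕ} (Ω : Set (Fin m → ℂ))
    (F : (Fin m → ℂ) → (Fin m → ℂ) → ℂ) : Prop :=
  ∀ (n : ℕ) (u : Fin n → Fin m → ℂ), (∀ a, u a ∈ Ω) →
    (Matrix.of fun a b => F (u a) (u b)).PosSemidef

/-- A kernel `F` with values in the `m × m` matrices is positive definite on `Ω`: every block
matrix with blocks `F (u a) (u b)` built from finitely many points of `Ω` is Hermitian and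
nonnegative. -/
def IsPosDefMatrixKernelOn {m : ℕ} (Ω : Set (Fin m → ℂ))
    (F : (Fin m → ℂ) → (Fin m → ℂ) → Matrix (Fin m) (Fin m) ℂ) : Prop :=
  ∀ (n : ℕ) (u : Fin n → Fin m → ℂ), (∀ a, u a ∈ Ω) →
    (Matrix.of fun p q : Fin n × Fin m => F (u p.1) (u q.1) p.2 q.2).PosSemidef

/-- A matrix-valued function `G` on `Ω` is a *positive definite function*: it has a polarization
`F` to `Ω × Ω`, holomorphic in the first and anti-holomorphic in the second variable, with
`F w w = G w`, and the kernel `F` is positive definite. -/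
def IsPositiveDefiniteFunction {m : ℕ} (Ω : Set (Fin m → ℂ))
    (G : (Fin m → ℂ) → Matrix (Fin m) (Fin m) ℂ) : Prop :=
  ∃ F : (Fin m → ℂ) → (Fin m → ℂ) → Matrix (Fin m) (Fin m) ℂ,
    (∀ i j, IsSesquiholomorphicOn Ω fun z w => F z w i j) ∧
    (∀ w ∈ Ω, F w w = G w) ∧
    IsPosDefMatrixKernelOn Ω F

/-- The order `G₁ ⪯ G₂` on `Ω`: the difference `G₂ - G₁` is a positive definite function. -/
def PrecOn {m : ℕ} (Ω : Set (Fin m → ℂ))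
    (G₁ G₂ : (Fin m → ℂ) → Matrix (Fin m) (Fin m) ℂ) : Prop :=
  IsPositiveDefiniteFunction Ω fun w => G₂ w - G₁ w

/-- A kernel `F` is infinitely divisible on `Ω`: every power `F ^ t`, `t > 0`, is positive
definite. The power is `exp (t * L)`, where `L` is the logarithm of `F` on `Ω × Ω` that is
holomorphic in the first variable, anti-holomorphic in the second and real on the diagonal. -/
def IsInfinitelyDivisibleOn {m : ℕ} (Ω : Set (Fin m → ℂ))
    (F : (Fin m → ℂ) → (Fin m → ℂ) → ℂ) : Prop :=
  ∃ L : (Fin m → ℂ) → (Fin m → ℂ) → ℂ,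
    IsSesquiholomorphicOn Ω L ∧
    (∀ z ∈ Ω, ∀ w ∈ Ω, Complex.exp (L z w) = F z w) ∧
    (∀ w ∈ Ω, (L w w).im = 0) ∧
    ∀ t : ℝ, 0 < t → IsPosDefKernelOn Ω fun z w => Complex.exp (t * L z w)

/-! ### The complex Hessian -/

/-- The Wirtinger derivative `∂f/∂w_i = (∂f/∂x_i - i ∂f/∂y_i) / 2`. -/
def wirtinger {m : ℕ} (i : Fin m) (f : (Fin m → ℂ) → ℂ) (w : Fin m → ℂ) : ℂ :=
  (fderiv ℝ f w (Pi.single i 1) - Complex.I * fderiv ℝ f w (Pi.single i Complex.I)) / 2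

/-- The Wirtinger derivative `∂f/∂(conj w_i) = (∂f/∂x_i + i ∂f/∂y_i) / 2`. -/
def wirtingerBar {m : ℕ} (i : Fin m) (f : (Fin m → ℂ) → ℂ) (w : Fin m → ℂ) : ℂ :=
  (fderiv ℝ f w (Pi.single i 1) + Complex.I * fderiv ℝ f w (Pi.single i Complex.I)) / 2

/-- The matrix `(∂²u / ∂w_i ∂(conj w_j))` of a real-valued function `u`. -/
def complexHessian {m : ℕ} (u : (Fin m → ℂ) → ℝ) (w : Fin m → ℂ) : Matrix (Fin m) (Fin m) ℂ :=
  Matrix.of fun i j => wirtinger i (wirtingerBar j fun z => (u z : ℂ)) w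

/-! ### Operator tuples -/

section Operators

variable {m : ℕ} {H : Type*} [NormedAddCommGroup H] [InnerProductSpace ℂ H]

/-- The operator `x ↦ ((T_1 - w_1) x, …, (T_m - w_m) x)` from `H` to `H ⊕ ⋯ ⊕ H`. -/
def tupleMap (T : Fin m → H →L[ℂ] H) (w : Fin m → ℂ) : H →L[ℂ] (Fin m → H) :=
  ContinuousLinearMap.pi fun i => T i - w i • ContinuousLinearMap.id ℂ H

/-- The joint kernel `⋂ i, ker (T_i - w_i)`. -/
def jointKernel (T : Fin m → H →L[ℂ] H) (w : Fin m → ℂ) : Submodule ℂ H :=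
  LinearMap.ker (tupleMap T w).toLinearMap

/-- The Cowen-Douglas class `B_n(Ω)` of commuting `m`-tuples. -/
structure IsCowenDouglas (n : ℕ) (Ω : Set (Fin m → ℂ)) (T : Fin m → H →L[ℂ] H) : Prop where
  commute : ∀ i j, Commute (T i) (T j)
  isClosed_range : ∀ w ∈ Ω, IsClosed (Set.range (tupleMap T w))
  rank_jointKernel : ∀ w ∈ Ω, Module.rank ℂ (jointKernel T w) = n
  dense_span : (⨆ w ∈ Ω, jointKernel T w).topologicalClosure = ⊤

/-- `γ` is, near `w`, a non-vanishing holomorphic section of the bundle of joint kernels of `T`. -/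
def IsLocalSection (T : Fin m → H →L[ℂ] H) (w : Fin m → ℂ) (γ : (Fin m → ℂ) → H) : Prop :=
  ∃ U : Set (Fin m → ℂ), IsOpen U ∧ w ∈ U ∧ DifferentiableOn ℂ γ U ∧
    ∀ z ∈ U, γ z ≠ 0 ∧ γ z ∈ jointKernel T z

open Classical in
/-- The curvature matrix `(-∂² log ‖γ‖² / ∂w_i ∂(conj w_j))` at `w` of a tuple in the class `B_1`,
where `γ` is a non-vanishing holomorphic section of the line bundle of joint kernels near `w`;
the matrix does not depend on the section. -/
def curvatureMatrix (T : Fin m → H →L[ℂ] H) (w : Fin m → ℂ) : Matrix (Fin m) (Fin m) ℂ :=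
  if h : ∃ γ, IsLocalSection T w γ then
    -complexHessian (fun z => Real.log (‖h.choose z‖ ^ 2)) w
  else 0

end Operators

/-- The tuple `M` consists of the multiplications by the coordinate functions on a Hilbert space
of functions on `Ω`. -/
def IsMultiplicationTuple {m : ℕ} {H : Type*} [NormedAddCommGroup H] [InnerProductSpace ℂ H]
    {Ω : Set (Fin m → ℂ)} [RKHS ℂ H Ω ℂ] (M : Fin m → H →L[ℂ] H) : Prop :=
  ∀ (i : Fin m) (f : H) (z : Ω), M i f z = z.1 i * f z

/-- `M`, on the Hilbert space with reproducing kernel `K` on the polydisc, is an infinitely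
divisible `m`-tuple of contractions. -/
def IsInfinitelyDivisibleTupleOfContractions {m : ℕ} {H : Type*} [NormedAddCommGroup H]
    [InnerProductSpace ℂ H] (K : (Fin m → ℂ) → (Fin m → ℂ) → ℂ) (M : Fin m → H →L[ℂ] H) : Prop :=
  (∀ i, ‖M i‖ ≤ 1) ∧
    IsInfinitelyDivisibleOn (polydisc m) fun z w => (szegoKernel z w)⁻¹ * K z w

/-! ### The shift on the Hardy space -/

/-- The Hardy space of the polydisc: a function `∑ a_I z^I` is given by its square-summable family
of Taylor coefficients `a_I`, and the monomials `z^I` are an orthonormal basis. -/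
abbrev HardySpace (m : ℕ) : Type := lp (fun _ : Fin m → ℕ => ℂ) 2

/-- The monomial `z^I` in the Hardy space. -/
def monomial {m : ℕ} (I : Fin m → ℕ) : HardySpace m := lp.single 2 I (1 : ℂ)

theorem orthonormal_monomial_shift {m : ℕ} (i : Fin m) :
    Orthonormal ℂ fun I : Fin m → ℕ => monomial (I + Pi.single i 1) := by
  have h : Orthonormal ℂ (monomial (m := m)) := by
    rw [orthonormal_iff_ite]
    intro I J
    simp only [monomial]
    rw [lp.inner_single_left]
    simp [Pi.single_apply]
  exact h.comp _ fun I J hIJ => add_right_cancel hIJ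

/-- The shift `S_i` on the Hardy space, that is, multiplication by `z_i`: it is the isometry that
maps `z^I` to `z_i z^I`. -/
def hardyShift {m : ℕ} (i : Fin m) : HardySpace m →L[ℂ] HardySpace m :=
  (orthonormal_monomial_shift i).orthogonalFamily.linearIsometry.toContinuousLinearMap

theorem hardyShift_monomial {m : ℕ} (i : Fin m) (I : Fin m → ℕ) :
    hardyShift i (monomial I) = monomial (I + Pi.single i 1) := by
  simp [hardyShift, monomial]

end CowenDouglas

end

/-! Put Q(z, v) = S(z, v̄)⁻¹ K(z, v̄) (`quotientKernel`), a holomorphic function of the pair (z, v).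
A holomorphic function of (z, v) is determined by its values on v = z̄ (`eqOn_zero_of_diagonal`), so
the Hessian in condition 1 has only one polarization, which near the diagonal is the matrix ∂² log Q
/ ∂z_i ∂v_j. `mixedLog` writes its entries without choosing a branch of the logarithm.

From infinite divisibility to condition 1: if exp(tL) is positive definite for every t > 0, the
derivative at t = 0 shows that L is nonnegative on coefficient vectors with sum zero
(`sum_nonneg_of_exp`). Second differences have such coefficients, and their quotients converge to
the mixed derivatives of L, which therefore form a positive definite kernel
(`isPosDefMatrixKernelOn_mixed`).

Conversely, let F be a positive definite polarization of the Hessian. Integrating F twice along rays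
from the origin gives P(z, v) = ∑ z_i v_j ∫∫ F_ij(sz, conj(tv)) ds dt, and z, w ↦ P(z, w̄) is
positive definite as a limit of Riemann sums (`isPosDefKernelOn_potential`). Near the origin P is
the second difference log Q(z, v) - log Q(z, 0) - log Q(0, v) + log Q(0, 0), so exp(P) Q(z, 0) Q(0,
v) = Q(z, v) Q(0, 0), and this identity extends to the whole domain (`potential_spec`). It forces
Q(z, 0) ≠ 0; with a logarithm ℓ of Q(·, 0) the function L(z, w) = P(z, w̄) + ℓ(z) + conj ℓ(w) - log
Q(0, 0) is the required logarithm, and exp(tL) is exp(tP) times a rank-one kernel times a positive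
constant. Contractivity comes from t = 1: multiplying S⁻¹K by all Szegő factors but the i-th one
shows that (1 - z_i w̄_i) K is positive definite.

For the curvatures, γ(w) = K(·, w̄) is a holomorphic section for the adjoint tuple, with ‖γ(w)‖² =
K(w̄, w̄). Hence the difference of the curvatures at w is the transpose of the Hessian of condition
1 at w̄ (`mixedLog_szegoKernel_sub`), and G(w) ↦ G(w̄)ᵀ preserves positive definite functions.
Holomorphy of the sections follows from weak holomorphy and local boundedness
(`differentiableOn_of_inner`). -/

noncomputable section

namespace CowenDouglas

open Metric Set Filter Topology MeasureTheory

/-! ### Holomorphic functions of several variables: identity theorem, derivatives, parameter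
integrals. -/

section SeveralVariables

variable {E : Type*} [NormedAddCommGroup E] [NormedSpace ℂ E]

/-- Two holomorphic functions on a ball that agree near the centre are equal. -/
theorem eqOn_ball_of_eventuallyEq {f g : E → ℂ} {r : ℝ}
    (hf : DifferentiableOn ℂ f (ball 0 r)) (hg : DifferentiableOn ℂ g (ball 0 r))
    (h : f =ᶠ[𝓝 0] g) : EqOn f g (ball 0 r) := by
  intro x hx
  -- On the complex line through 0 and x the one-variable identity theorem applies: the admissible
  -- parameters form a convex set.
  let l : ℂ → E := fun τ => τ • x
  have hl : Differentiable ℂ l := by fun_prop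
  set V : Set ℂ := l ⁻¹' ball 0 r with hV
  have hVo : IsOpen V := isOpen_ball.preimage hl.continuous
  have hr : 0 < r := (norm_nonneg x).trans_lt (mem_ball_zero_iff.1 hx)
  have hVc : Convex ℝ V := by
    have : V = (((LinearMap.toSpanSingleton ℂ E x).restrictScalars ℝ)) ⁻¹' ball 0 r := by
      ext; simp [hV, l]
    rw [this]
    exact (convex_ball _ _).linear_preimage _
  have h1 : AnalyticOnNhd ℂ (f ∘ l) V :=
    (hf.comp hl.differentiableOn fun _ h => h).analyticOnNhd hVo
  have h2 : AnalyticOnNhd ℂ (g ∘ l) V :=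
    (hg.comp hl.differentiableOn fun _ h => h).analyticOnNhd hVo
  have h0 : (0 : ℂ) ∈ V := by simp [hV, l, hr]
  have h3 : f ∘ l =ᶠ[𝓝 0] g ∘ l := by
    have : Tendsto l (𝓝 0) (𝓝 0) := by
      have := hl.continuous.tendsto 0
      simpa [l] using this
    exact this.eventually h
  have := h1.eqOn_of_preconnected_of_eventuallyEq h2 hVc.isPreconnected h0 h3
    (show (1 : ℂ) ∈ V by simpa [hV, l] using hx)
  simpa [l] using this

variable [FiniteDimensional ℂ E]

/-- In a fixed direction v the derivative is a Cauchy integral of f over a small circle in the line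
x + ℂv. This can be differentiated in x under the integral sign, the dominating constant coming from
the Cauchy estimate. A basis of E then assembles the directional statements. -/
theorem differentiableOn_fderiv {f : E → ℂ} {U : Set E} (hU : IsOpen U)
    (hf : DifferentiableOn ℂ f U) : DifferentiableOn ℂ (fderiv ℂ f) U := by
  have hclm : ∀ v : E, ∀ x₀ ∈ U, DifferentiableAt ℂ (fun x => fderiv ℂ f x v) x₀ := by
    intro v x₀ hx₀
    have hcont : ContinuousAt f x₀ := (hf.differentiableAt (hU.mem_nhds hx₀)).continuousAt
    obtain ⟨ε, hε, hball⟩ : ∃ ε > 0, ball x₀ ε ⊆ U ∩ {x | ‖f x‖ ≤ ‖f x₀‖ + 1} := by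
      refine Metric.mem_nhds_iff.1 (inter_mem (hU.mem_nhds hx₀) ?_)
      filter_upwards [hcont.norm.eventually_lt continuousAt_const (lt_add_one ‖f x₀‖)] with x hx
      exact hx.le
    set C := ‖f x₀‖ + 1 with hC
    have hC0 : 0 < C := by positivity
    -- With one third of ε, a ball of radius R about any point of `ball x₀ (2 * R)` stays where f is
    -- bounded by C. The circle below has radius ρ with ρ‖v‖ < R, so it does not leave `ball x₀ (2 *
    -- R)` when x is in `ball x₀ R`.
    set R := ε / 3 with hR
    have hR0 : 0 < R := by positivity
    have hderiv_le : ∀ y ∈ ball x₀ (2 * R), ‖fderiv ℂ f y‖ ≤ 2 * C / R := by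
      intro y hy
      have hsub : ball y R ⊆ ball x₀ ε := by
        refine ball_subset_ball' ?_
        rw [mem_ball] at hy
        linarith
      refine Complex.norm_fderiv_le_div_of_mapsTo_ball
        (hf.mono fun z hz => (hball (hsub hz)).1) (fun z hz => ?_) hR0
      rw [mem_closedBall, dist_eq_norm]
      have h1 := (hball (hsub hz)).2
      have h2 := (hball (hsub (mem_ball_self hR0))).2
      calc ‖f z - f y‖ ≤ ‖f z‖ + ‖f y‖ := norm_sub_le _ _
        _ ≤ C + C := add_le_add h1 h2
        _ = 2 * C := by ring
    set ρ := R / (‖v‖ + 1) with hρ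
    have hρ0 : 0 < ρ := by positivity
    have hρv : ρ * ‖v‖ < R := by
      rw [hρ, div_mul_eq_mul_div, div_lt_iff₀ (by positivity)]
      nlinarith
    have hmem : ∀ x ∈ ball x₀ R, ∀ ζ : ℂ, ‖ζ‖ ≤ ρ → x + ζ • v ∈ ball x₀ (2 * R) := by
      intro x hx ζ hζ
      rw [mem_ball, dist_eq_norm] at hx ⊢
      calc ‖x + ζ • v - x₀‖ = ‖(x - x₀) + ζ • v‖ := by congr 1; abel
        _ ≤ ‖x - x₀‖ + ‖ζ • v‖ := norm_add_le _ _
        _ < R + R := by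
            refine add_lt_add hx ?_
            rw [norm_smul]
            exact lt_of_le_of_lt (mul_le_mul_of_nonneg_right hζ (norm_nonneg _)) hρv
        _ = 2 * R := by ring
    have hsub2 : ball x₀ (2 * R) ⊆ U := fun y hy =>
      (hball (ball_subset_ball (by linarith) hy)).1
    have hdiff : ∀ y ∈ ball x₀ (2 * R), HasFDerivAt f (fderiv ℂ f y) y := fun y hy =>
      (hf.differentiableAt (hU.mem_nhds (hsub2 hy))).hasFDerivAt
    set c : ℝ → ℂ := fun θ => deriv (circleMap 0 ρ) θ * (1 / (circleMap 0 ρ θ - 0) ^ 2) with hc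
    have hnc : ∀ θ, ‖circleMap 0 ρ θ‖ = ρ := fun θ => by simp [abs_of_pos hρ0]
    have hcc : Continuous c := by
      simp only [hc, deriv_circleMap, sub_zero]
      refine (((continuous_circleMap 0 ρ).mul continuous_const)).mul
        (continuous_const.div ((continuous_circleMap 0 ρ).pow 2) fun θ => ?_)
      exact pow_ne_zero _ (norm_pos_iff.1 (by rw [hnc]; exact hρ0))
    have hform : ∀ x ∈ ball x₀ R, fderiv ℂ f x v =
        (2 * Real.pi * Complex.I)⁻¹ *
          ∫ θ in (0 : ℝ)..2 * Real.pi, c θ * f (x + circleMap 0 ρ θ • v) := by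
      intro x hx
      have hd : DifferentiableOn ℂ (fun ζ : ℂ => f (x + ζ • v)) (closedBall 0 ρ) := by
        intro ζ hζ
        have h1 := (hdiff _ (hmem x hx ζ (by simpa using hζ))).differentiableAt
        exact (DifferentiableAt.comp ζ h1 (by fun_prop)).differentiableWithinAt
      have hD : deriv (fun ζ : ℂ => f (x + ζ • v)) 0 = fderiv ℂ f x v := by
        have h1 : HasFDerivAt f (fderiv ℂ f x) (x + (0 : ℂ) • v) := by
          have := hdiff _ (hmem x hx 0 (by simpa using hρ0.le))
          simpa using this
        have h2 : HasDerivAt (fun ζ : ℂ => x + ζ • v) v 0 := by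
          simpa using ((hasDerivAt_id (0 : ℂ)).smul_const v).const_add x
        exact (h1.comp_hasDerivAt (0 : ℂ) h2).deriv
      have := hd.deriv_eq_smul_circleIntegral hρ0
      rw [hD, circleIntegral] at this
      simp only [smul_eq_mul] at this
      have h2 : (2 * Real.pi * Complex.I : ℂ) ≠ 0 := Complex.two_pi_I_ne_zero
      rw [eq_inv_mul_iff_mul_eq₀ h2, ← this]
      refine intervalIntegral.integral_congr fun θ _ => ?_
      simp only [hc]
      ring
    -- Continuity of the derivative is not yet available, so measurability of the differentiated
    -- integrand rests on Borel measurability of `fderiv ℂ f`.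
    borelize E
    have hline : ∀ x : E, Continuous fun θ : ℝ => x + circleMap 0 ρ θ • v := fun x => by
      fun_prop
    have hGcont : ∀ x ∈ ball x₀ R, Continuous fun θ : ℝ => c θ * f (x + circleMap 0 ρ θ • v) := by
      intro x hx
      refine hcc.mul (continuous_iff_continuousAt.2 fun θ => ?_)
      have h1 := (hdiff _ (hmem x hx (circleMap 0 ρ θ) (hnc θ).le)).continuousAt
      exact ContinuousAt.comp (f := fun θ : ℝ => x + circleMap 0 ρ θ • v) (g := f) h1
        (hline x).continuousAt
    have hcb : ∀ θ, ‖c θ‖ ≤ ρ⁻¹ := by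
      intro θ
      simp only [hc, deriv_circleMap, sub_zero, norm_mul, hnc, norm_div, norm_pow, Complex.norm_I,
        norm_one]
      refine le_of_eq ?_
      field_simp
    have hmain := intervalIntegral.hasFDerivAt_integral_of_dominated_of_fderiv_le
      (μ := volume) (a := 0) (b := 2 * Real.pi)
      (F := fun x θ => c θ * f (x + circleMap 0 ρ θ • v))
      (F' := fun x θ => c θ • fderiv ℂ f (x + circleMap 0 ρ θ • v))
      (x₀ := x₀) (s := ball x₀ R) (bound := fun _ => ρ⁻¹ * (2 * C / R))
      (𝕜 := ℂ) (ball_mem_nhds _ hR0)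
      (by
        filter_upwards [ball_mem_nhds x₀ hR0] with x hx
        exact (hGcont x hx).aestronglyMeasurable)
      ((hGcont x₀ (mem_ball_self hR0)).intervalIntegrable _ _)
      (by
        refine hcc.aestronglyMeasurable.smul (Measurable.aestronglyMeasurable ?_)
        exact (measurable_fderiv ℂ f).comp (hline x₀).measurable)
      (by
        refine Eventually.of_forall fun θ _ x hx => ?_
        rw [norm_smul]
        exact mul_le_mul (hcb θ) (hderiv_le _ (hmem x hx _ (hnc θ).le)) (norm_nonneg _)
          (by positivity))
      (by simp)
      (by
        refine Eventually.of_forall fun θ _ x hx => ?_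
        have h1 := hdiff _ (hmem x hx _ (hnc θ).le)
        have h2 : HasFDerivAt (fun x : E => x + circleMap 0 ρ θ • v)
            (ContinuousLinearMap.id ℂ E) x := (hasFDerivAt_id x).add_const _
        exact (h1.comp x h2).const_mul (c θ))
    refine (hmain.differentiableAt.const_mul (2 * Real.pi * Complex.I)⁻¹).congr_of_eventuallyEq ?_
    filter_upwards [ball_mem_nhds x₀ hR0] with x hx
    exact hform x hx
  let b := Module.finBasis ℂ E
  have hrep : fderiv ℂ f = fun x => ∑ i, fderiv ℂ f x (b i) •
      LinearMap.toContinuousLinearMap (b.coord i) := by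
    funext x
    ext y
    conv_lhs => rw [← b.sum_repr y, map_sum]
    simp [mul_comm]
  intro x hx
  rw [hrep]
  refine DifferentiableAt.differentiableWithinAt (DifferentiableAt.fun_sum fun i _ => ?_)
  exact (hclm (b i) x hx).smul_const _

theorem differentiableOn_fderiv_apply {f : E → ℂ} {U : Set E} (hU : IsOpen U)
    (hf : DifferentiableOn ℂ f U) (v : E) : DifferentiableOn ℂ (fun x => fderiv ℂ f x v) U :=
  (differentiableOn_fderiv hU hf).clm_apply (differentiableOn_const v)

/-- The integral of a holomorphic function along a family of contractions of the ball. -/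
theorem differentiableOn_integral_comp {f : E → ℂ} {r : ℝ} (hf : DifferentiableOn ℂ f (ball 0 r))
    {φ : ℝ → E →L[ℂ] E} (hφ : Continuous φ) (hφ1 : ∀ s ∈ Icc (0 : ℝ) 1, ∀ x, ‖φ s x‖ ≤ ‖x‖) :
    DifferentiableOn ℂ (fun x => ∫ s in (0 : ℝ)..1, f (φ s x)) (ball 0 r) := by
  intro x₀ hx₀
  rw [mem_ball_zero_iff] at hx₀
  -- The contractions map the closed ball of radius ρ to itself. It is compact, which bounds the
  -- derivative uniformly in the parameter.
  obtain ⟨ρ, hρ1, hρ2⟩ := exists_between hx₀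
  have := FiniteDimensional.proper ℂ E
  have hsub : closedBall (0 : E) ρ ⊆ ball 0 r := closedBall_subset_ball hρ2
  have hdf := differentiableOn_fderiv isOpen_ball hf
  obtain ⟨C, hC⟩ := (isCompact_closedBall (0 : E) ρ).exists_bound_of_continuousOn
    (hdf.continuousOn.mono hsub)
  have hmem : ∀ x ∈ ball (0 : E) ρ, ∀ s ∈ Icc (0 : ℝ) 1, φ s x ∈ closedBall (0 : E) ρ := by
    intro x hx s hs
    rw [mem_closedBall_zero_iff]
    exact (hφ1 s hs x).trans (mem_ball_zero_iff.1 hx).le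
  have hI : ∀ s ∈ uIoc (0 : ℝ) 1, s ∈ Icc (0 : ℝ) 1 := fun s hs => by
    rw [uIoc_of_le zero_le_one] at hs
    exact Ioc_subset_Icc_self hs
  have hx₀' : x₀ ∈ ball (0 : E) ρ := mem_ball_zero_iff.2 hρ1
  have hcont : ∀ x, Continuous fun s => φ s x := fun x => hφ.clm_apply continuous_const
  have hGc : ∀ x ∈ ball (0 : E) ρ, ContinuousOn (fun s => f (φ s x)) (Icc 0 1) := fun x hx =>
    hf.continuousOn.comp (hcont x).continuousOn fun s hs => hsub (hmem x hx s hs)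
  have hmain := intervalIntegral.hasFDerivAt_integral_of_dominated_of_fderiv_le
    (μ := volume) (a := 0) (b := 1) (F := fun x s => f (φ s x))
    (F' := fun x s => (fderiv ℂ f (φ s x)).comp (φ s))
    (x₀ := x₀) (s := ball 0 ρ) (bound := fun _ => C) (𝕜 := ℂ)
    (isOpen_ball.mem_nhds hx₀')
    (by
      filter_upwards [isOpen_ball.mem_nhds hx₀'] with x hx
      rw [uIoc_of_le zero_le_one]
      exact ((hGc x hx).mono Ioc_subset_Icc_self).aestronglyMeasurable measurableSet_Ioc)
    (by
      refine ContinuousOn.intervalIntegrable ?_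
      rw [uIcc_of_le zero_le_one]
      exact hGc x₀ hx₀')
    (by
      rw [uIoc_of_le zero_le_one]
      refine ContinuousOn.aestronglyMeasurable (ContinuousOn.mono ?_ Ioc_subset_Icc_self)
        measurableSet_Ioc (s := Ioc (0 : ℝ) 1)
      refine ContinuousOn.clm_comp ?_ hφ.continuousOn
      exact hdf.continuousOn.comp (hcont x₀).continuousOn fun s hs => hsub (hmem x₀ hx₀' s hs))
    (by
      refine Eventually.of_forall fun s hs x hx => ?_
      have hs' := hI s hs
      have h1 := hC _ (hmem x hx s hs')
      have h2 : ‖φ s‖ ≤ 1 := ContinuousLinearMap.opNorm_le_bound _ zero_le_one fun y => by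
        simpa using hφ1 s hs' y
      calc _ ≤ ‖fderiv ℂ f (φ s x)‖ * ‖φ s‖ := ContinuousLinearMap.opNorm_comp_le _ _
        _ ≤ C * 1 := mul_le_mul h1 h2 (norm_nonneg _) ((norm_nonneg _).trans h1)
        _ = C := mul_one C)
    (by simp)
    (by
      refine Eventually.of_forall fun s hs x hx => ?_
      have h1 := (hf.differentiableAt (isOpen_ball.mem_nhds
        (hsub (hmem x hx s (hI s hs))))).hasFDerivAt
      exact h1.comp x (φ s).hasFDerivAt)
  exact hmain.differentiableAt.differentiableWithinAt

end SeveralVariables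

/-! ### Positive definite kernels: sums, Schur products, exponentials, limits. -/

section PositiveKernels

/-- Over ℂ the Hermitian condition is automatic: a quadratic form with real values comes from a
Hermitian matrix. Later positivity proofs thus reduce to one inequality in the order of ℂ. -/
theorem posSemidef_iff_sum_nonneg {ι : Type*} [Fintype ι] {A : Matrix ι ι ℂ} :
    A.PosSemidef ↔ ∀ x : ι → ℂ, 0 ≤ ∑ a, ∑ b, star (x a) * A a b * x b := by
  classical
  have key : ∀ x : ι → ℂ, star x ⬝ᵥ A.mulVec x = ∑ a, ∑ b, star (x a) * A a b * x b := fun x => by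
    simp [dotProduct, Matrix.mulVec, Finset.mul_sum, mul_assoc]
  refine ⟨fun h x => key x ▸ h.dotProduct_mulVec_nonneg x, fun h => ?_⟩
  rw [← Matrix.isPositive_toEuclideanLin_iff, LinearMap.isPositive_iff_complex]
  intro x
  have h1 : inner ℂ (A.toEuclideanLin x) x = star (∑ a, ∑ b, star (x a) * A a b * x b) := by
    rw [← key x, ← inner_conj_symm, starRingEnd_apply, EuclideanSpace.inner_eq_star_dotProduct,
      dotProduct_comm]
    rfl
  have h2 : 0 ≤ ∑ a, ∑ b, star (x a) * A a b * x b := h x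
  rw [h1]
  generalize (∑ a, ∑ b, star (x a) * A a b * x b) = q at h2
  obtain ⟨hre, him⟩ := Complex.le_def.1 h2
  refine ⟨Complex.ext (by simp) ?_, by simpa using hre⟩
  simpa using him.symm

theorem posSemidef_of_tendsto {ι α : Type*} [Fintype ι] {l : Filter α} [l.NeBot]
    {A : α → Matrix ι ι ℂ} {B : Matrix ι ι ℂ} (hA : ∀ᶠ n in l, (A n).PosSemidef)
    (h : ∀ i j, Tendsto (fun n => A n i j) l (𝓝 (B i j))) : B.PosSemidef := by
  rw [posSemidef_iff_sum_nonneg]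
  intro x
  have hlim : Tendsto (fun n => ∑ a, ∑ b, star (x a) * A n a b * x b) l
      (𝓝 (∑ a, ∑ b, star (x a) * B a b * x b)) :=
    tendsto_finsetSum _ fun a _ => tendsto_finsetSum _ fun b _ =>
      ((h a b).const_mul _).mul_const _
  refine ge_of_tendsto hlim ?_
  filter_upwards [hA] with n hn
  exact posSemidef_iff_sum_nonneg.1 hn x

variable {m : ℕ} {Ω : Set (Fin m → ℂ)} {F G : (Fin m → ℂ) → (Fin m → ℂ) → ℂ}

theorem IsPosDefKernelOn.posSemidef (hF : IsPosDefKernelOn Ω F) {ι : Type*} [Fintype ι]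
    (u : ι → Fin m → ℂ) (hu : ∀ a, u a ∈ Ω) :
    (Matrix.of fun a b => F (u a) (u b)).PosSemidef := by
  let e := Fintype.equivFin ι
  have := (hF (Fintype.card ι) (u ∘ e.symm) fun a => hu _).submatrix e
  convert this using 1
  ext a b
  simp

theorem IsPosDefMatrixKernelOn.posSemidef
    {F : (Fin m → ℂ) → (Fin m → ℂ) → Matrix (Fin m) (Fin m) ℂ}
    (hF : IsPosDefMatrixKernelOn Ω F) {ι : Type*} [Fintype ι]
    (u : ι → Fin m → ℂ) (hu : ∀ a, u a ∈ Ω) :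
    (Matrix.of fun p q : ι × Fin m => F (u p.1) (u q.1) p.2 q.2).PosSemidef := by
  let e := Fintype.equivFin ι
  have := (hF (Fintype.card ι) (u ∘ e.symm) fun a => hu _).submatrix
    (Prod.map e id : ι × Fin m → _)
  convert this using 1
  ext a b
  simp

theorem IsPosDefKernelOn.of_tendsto {α : Type*} {l : Filter α} [l.NeBot]
    {f : α → (Fin m → ℂ) → (Fin m → ℂ) → ℂ} (hf : ∀ᶠ n in l, IsPosDefKernelOn Ω (f n))
    (h : ∀ z ∈ Ω, ∀ w ∈ Ω, Tendsto (fun n => f n z w) l (𝓝 (F z w))) : IsPosDefKernelOn Ω F :=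
  fun n u hu => posSemidef_of_tendsto (hf.mono fun _ hk => hk n u hu)
    fun i j => h _ (hu i) _ (hu j)

theorem IsPosDefKernelOn.congr (hF : IsPosDefKernelOn Ω F)
    (h : ∀ z ∈ Ω, ∀ w ∈ Ω, F z w = G z w) : IsPosDefKernelOn Ω G := fun n u hu => by
  convert hF n u hu using 1
  ext a b
  exact (h _ (hu a) _ (hu b)).symm

theorem IsPosDefKernelOn.mul (hF : IsPosDefKernelOn Ω F) (hG : IsPosDefKernelOn Ω G) :
    IsPosDefKernelOn Ω fun z w => F z w * G z w :=
  fun n u hu => (hF n u hu).hadamard (hG n u hu)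

theorem IsPosDefKernelOn.add (hF : IsPosDefKernelOn Ω F) (hG : IsPosDefKernelOn Ω G) :
    IsPosDefKernelOn Ω fun z w => F z w + G z w :=
  fun n u hu => (hF n u hu).add (hG n u hu)

theorem isPosDefKernelOn_mul_star (f : (Fin m → ℂ) → ℂ) :
    IsPosDefKernelOn Ω fun z w => f z * star (f w) := fun n u _ => by
  rw [posSemidef_iff_sum_nonneg]
  intro x
  have : ∑ a, ∑ b, star (x a) * (f (u a) * star (f (u b))) * x b =
      (∑ a, star (x a) * f (u a)) * star (∑ a, star (x a) * f (u a)) := by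
    rw [star_sum, Finset.sum_mul_sum]
    refine Finset.sum_congr rfl fun a _ => Finset.sum_congr rfl fun b _ => ?_
    simp only [star_mul', star_star]
    ring
  simp only [Matrix.of_apply]
  rw [this]
  exact mul_star_self_nonneg _

theorem isPosDefKernelOn_const {c : ℝ} (hc : 0 ≤ c) : IsPosDefKernelOn Ω fun _ _ => (c : ℂ) := by
  refine (isPosDefKernelOn_mul_star (m := m) (Ω := Ω) fun _ => (Real.sqrt c : ℂ)).congr ?_
  intro z _ w _
  simp only [RCLike.star_def, Complex.conj_ofReal]
  rw [← Complex.ofReal_mul, Real.mul_self_sqrt hc]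

theorem isPosDefKernelOn_one : IsPosDefKernelOn Ω fun _ _ => 1 := by
  simpa using isPosDefKernelOn_const (Ω := Ω) zero_le_one

theorem IsPosDefKernelOn.pow (hF : IsPosDefKernelOn Ω F) (k : ℕ) :
    IsPosDefKernelOn Ω fun z w => F z w ^ k := by
  induction k with
  | zero => simpa using isPosDefKernelOn_one
  | succ k ih => simpa only [pow_succ] using ih.mul hF

theorem isPosDefKernelOn_sum {ι : Type*} (s : Finset ι)
    {f : ι → (Fin m → ℂ) → (Fin m → ℂ) → ℂ} (hf : ∀ i ∈ s, IsPosDefKernelOn Ω (f i)) :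
    IsPosDefKernelOn Ω fun z w => ∑ i ∈ s, f i z w := by
  classical
  induction s using Finset.induction_on with
  | empty => simpa using isPosDefKernelOn_const (Ω := Ω) le_rfl
  | insert a s ha ih =>
    simp only [Finset.sum_insert ha]
    exact (hf a (Finset.mem_insert_self a s)).add
      (ih fun i hi => hf i (Finset.mem_insert_of_mem hi))

theorem isPosDefKernelOn_prod {ι : Type*} (s : Finset ι)
    {f : ι → (Fin m → ℂ) → (Fin m → ℂ) → ℂ} (hf : ∀ i ∈ s, IsPosDefKernelOn Ω (f i)) :
    IsPosDefKernelOn Ω fun z w => ∏ i ∈ s, f i z w := by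
  classical
  induction s using Finset.induction_on with
  | empty => simpa using isPosDefKernelOn_one
  | insert a s ha ih =>
    simp only [Finset.prod_insert ha]
    exact (hf a (Finset.mem_insert_self a s)).mul
      (ih fun i hi => hf i (Finset.mem_insert_of_mem hi))

/-- The exponential is the limit of (1 + F/k)^k, and each of these is positive definite by sums and
Schur products. -/
theorem IsPosDefKernelOn.exp (hF : IsPosDefKernelOn Ω F) :
    IsPosDefKernelOn Ω fun z w => Complex.exp (F z w) := by
  refine IsPosDefKernelOn.of_tendsto (l := atTop)
    (f := fun (k : ℕ) z w => (1 + ((k : ℝ)⁻¹ : ℝ) * F z w) ^ k)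
    (Eventually.of_forall fun k => ?_) fun z _ w _ => ?_
  · exact (isPosDefKernelOn_one.add
      ((isPosDefKernelOn_const (inv_nonneg.2 (Nat.cast_nonneg k))).mul hF)).pow k
  · have := Complex.tendsto_one_add_div_pow_exp (F z w)
    simpa [div_eq_inv_mul] using this

/-- A geometric series in a rank-one kernel. These factors are what turns S⁻¹K into (1 - z_i w̄_i)
K. -/
theorem isPosDefKernelOn_geometric (i : Fin m) :
    IsPosDefKernelOn (polydisc m) fun z w => (1 - z i * star (w i))⁻¹ := by
  refine IsPosDefKernelOn.of_tendsto (l := atTop)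
    (f := fun (k : ℕ) z w => ∑ j ∈ Finset.range k, (z i * star (w i)) ^ j)
    (Eventually.of_forall fun k => isPosDefKernelOn_sum _ fun j _ =>
      (isPosDefKernelOn_mul_star fun z : Fin m → ℂ => z i).pow j) fun z hz w hw => ?_
  refine (hasSum_geometric_of_norm_lt_one ?_).tendsto_sum_nat
  rw [norm_mul, norm_star]
  exact mul_lt_one_of_nonneg_of_lt_one_left (norm_nonneg _) (hz i) (hw i).le

end PositiveKernels

/-! ### Positivity of double integrals through Riemann sums. -/

section RiemannSums

/-- A Riemann sum over a uniform partition is close to the integral if the oscillation of the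
function over each cell is small. -/
theorem norm_integral_sub_riemannSum_le {f : ℝ → ℂ} (hf : ContinuousOn f (Icc 0 1)) {n : ℕ}
    (hn : 0 < n) {ε : ℝ}
    (h : ∀ s ∈ Icc (0 : ℝ) 1, ∀ t ∈ Icc (0 : ℝ) 1, |s - t| ≤ 1 / n → ‖f s - f t‖ ≤ ε) :
    ‖(∫ s in (0 : ℝ)..1, f s) - ∑ k : Fin n, (1 / n : ℂ) * f ((k : ℕ) / n)‖ ≤ ε := by
  have hn' : (0 : ℝ) < n := by exact_mod_cast hn
  have hmono : ∀ k : ℕ, (k : ℝ) / n ≤ ((k + 1 : ℕ) : ℝ) / n := fun k => by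
    gcongr; simp
  have hmem : ∀ k : ℕ, k ≤ n → (k : ℝ) / n ∈ Icc (0 : ℝ) 1 := fun k hk =>
    ⟨by positivity, by rw [div_le_one hn']; exact_mod_cast hk⟩
  have hint : ∀ k < n, IntervalIntegrable f volume ((k : ℝ) / n) (((k + 1 : ℕ) : ℝ) / n) := by
    intro k hk
    refine (hf.mono ?_).intervalIntegrable
    rw [uIcc_of_le (hmono k)]
    exact Icc_subset_Icc (hmem k hk.le).1 (hmem (k + 1) hk).2
  have hsum := intervalIntegral.sum_integral_adjacent_intervals
    (a := fun k : ℕ => (k : ℝ) / n) hint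
  simp only [Nat.cast_zero, zero_div, div_self hn'.ne'] at hsum
  rw [← hsum, Finset.sum_range, ← Finset.sum_sub_distrib]
  have hcell : ∀ k : Fin n, ‖(∫ s in (((k : ℕ) : ℝ) / n)..((((k : ℕ) + 1 : ℕ) : ℝ) / n), f s) -
      (1 / n : ℂ) * f (((k : ℕ) : ℝ) / n)‖ ≤ ε * (1 / n) := by
    intro k
    have hlen : (((k : ℕ) + 1 : ℕ) : ℝ) / n - ((k : ℕ) : ℝ) / n = 1 / n := by
      push_cast; ring
    have hc : (1 / n : ℂ) * f (((k : ℕ) : ℝ) / n) =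
        ∫ _ in (((k : ℕ) : ℝ) / n)..((((k : ℕ) + 1 : ℕ) : ℝ) / n), f (((k : ℕ) : ℝ) / n) := by
      rw [intervalIntegral.integral_const, hlen, Complex.real_smul]
      push_cast; rfl
    rw [hc, ← intervalIntegral.integral_sub (hint k k.2) (by simp)]
    have := intervalIntegral.norm_integral_le_of_norm_le_const (C := ε)
      (a := ((k : ℕ) : ℝ) / n) (b := (((k : ℕ) + 1 : ℕ) : ℝ) / n)
      (f := fun s => f s - f (((k : ℕ) : ℝ) / n)) ?_
    · rwa [hlen, abs_of_pos (by positivity)] at this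
    · intro s hs
      rw [uIoc_of_le (hmono k)] at hs
      refine h s ⟨(hmem k k.2.le).1.trans hs.1.le, hs.2.trans (hmem _ k.2).2⟩ _ (hmem k k.2.le) ?_
      rw [abs_of_nonneg (sub_nonneg.2 hs.1.le), ← hlen]
      linarith [hs.2]
  refine (norm_sum_le _ _).trans ((Finset.sum_le_sum fun k _ => hcell k).trans ?_)
  simp only [Finset.sum_const, Finset.card_univ, Fintype.card_fin, nsmul_eq_mul]
  rw [mul_comm ε, ← mul_assoc, mul_one_div_cancel hn'.ne', one_mul]

/-- The integral over the square of a continuous kernel with nonnegative sums is nonnegative. -/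
theorem integral_integral_nonneg {φ : ℝ → ℝ → ℂ}
    (hφ : ContinuousOn (Function.uncurry φ) (Icc 0 1 ×ˢ Icc 0 1))
    (hpos : ∀ (n : ℕ) (s : Fin n → ℝ), (∀ k, s k ∈ Icc (0 : ℝ) 1) →
      0 ≤ ∑ k, ∑ l, φ (s k) (s l)) :
    0 ≤ ∫ t in (0 : ℝ)..1, ∫ s in (0 : ℝ)..1, φ s t := by
  -- Clamping both variables to [0, 1] makes the kernel continuous on the whole plane without
  -- changing the integral.
  let p : ℝ → ℝ := fun s => projIcc (0 : ℝ) 1 zero_le_one s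
  have hpc : Continuous p := continuous_subtype_val.comp continuous_projIcc
  have hpm : ∀ s, p s ∈ Icc (0 : ℝ) 1 := fun s => (projIcc (0 : ℝ) 1 zero_le_one s).2
  have hpe : ∀ s ∈ Icc (0 : ℝ) 1, p s = s := fun s hs => by
    simp only [p]; rw [projIcc_of_mem zero_le_one hs]
  let ψ : ℝ → ℝ → ℂ := fun s t => φ (p s) (p t)
  have hψ : Continuous (Function.uncurry ψ) := by
    have : Continuous fun q : ℝ × ℝ => (p q.1, p q.2) := by fun_prop
    exact continuousOn_univ.1 (hφ.comp this.continuousOn fun q _ =>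
      ⟨hpm q.1, hpm q.2⟩)
  have heq : (∫ t in (0 : ℝ)..1, ∫ s in (0 : ℝ)..1, φ s t) =
      ∫ t in (0 : ℝ)..1, ∫ s in (0 : ℝ)..1, ψ s t := by
    refine intervalIntegral.integral_congr fun t ht => ?_
    refine intervalIntegral.integral_congr fun s hs => ?_
    rw [uIcc_of_le zero_le_one] at hs ht
    simp only [ψ, hpe s hs, hpe t ht]
  rw [heq]
  have hg : Continuous fun t => ∫ s in (0 : ℝ)..1, ψ s t :=
    intervalIntegral.continuous_parametric_intervalIntegral_of_continuous'
      (f := fun t s => ψ s t) (hψ.comp continuous_swap) 0 1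
  have hψs : ∀ t, Continuous fun s => ψ s t := fun t => by
    exact hψ.comp (Continuous.prodMk_left t)
  have huc := (isCompact_Icc.prod isCompact_Icc :
    IsCompact (Icc (0 : ℝ) 1 ×ˢ Icc (0 : ℝ) 1)).uniformContinuousOn_of_continuous hψ.continuousOn
  -- The cone of nonnegative numbers is closed in ℂ, so it suffices to approximate the integral by
  -- nonnegative Riemann sums. The inner and the outer integral cost ε/3 each.
  refine isClosed_Ici.closure_subset_iff.2 (Subset.refl (Ici (0 : ℂ)))
    (Metric.mem_closure_iff.2 fun ε hε => ?_)
  obtain ⟨δ, hδ, hδψ⟩ := Metric.uniformContinuousOn_iff_le.1 huc (ε / 3) (by positivity)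
  obtain ⟨n, hn⟩ := exists_nat_one_div_lt hδ
  set N := n + 1 with hN
  have hN0 : 0 < N := n.succ_pos
  have hNr : (0 : ℝ) < N := by exact_mod_cast hN0
  have hnδ : (1 : ℝ) / N < δ := by simpa [hN] using hn
  have hmem : ∀ k : Fin N, ((k : ℕ) : ℝ) / N ∈ Icc (0 : ℝ) 1 := fun k =>
    ⟨by positivity, by rw [div_le_one hNr]; exact_mod_cast k.2.le⟩
  have hosc : ∀ s ∈ Icc (0 : ℝ) 1, ∀ s' ∈ Icc (0 : ℝ) 1, ∀ t ∈ Icc (0 : ℝ) 1,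
      ∀ t' ∈ Icc (0 : ℝ) 1, |s - s'| ≤ 1 / N → |t - t'| ≤ 1 / N →
      ‖ψ s t - ψ s' t'‖ ≤ ε / 3 := by
    intro s hs s' hs' t ht t' ht' h1 h2
    have := hδψ (s, t) ⟨hs, ht⟩ (s', t') ⟨hs', ht'⟩ (by
      rw [Prod.dist_eq, max_le_iff, Real.dist_eq, Real.dist_eq]
      exact ⟨h1.trans hnδ.le, h2.trans hnδ.le⟩)
    simpa [dist_eq_norm] using this
  have h1 := norm_integral_sub_riemannSum_le hg.continuousOn hN0 (ε := ε / 3) (by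
    intro t ht t' ht' h
    rw [← intervalIntegral.integral_sub ((hψs t).intervalIntegrable _ _)
      ((hψs t').intervalIntegrable _ _)]
    have := intervalIntegral.norm_integral_le_of_norm_le_const (C := ε / 3) (a := 0) (b := 1)
      (f := fun s => ψ s t - ψ s t') (fun s hs => by
        rw [uIoc_of_le zero_le_one] at hs
        have hs' := Ioc_subset_Icc_self hs
        exact hosc s hs' s hs' t ht t' ht' (by simp) h)
    simpa using this)
  have h2 : ∀ l : Fin N, ‖(∫ s in (0 : ℝ)..1, ψ s (((l : ℕ) : ℝ) / N)) -
      ∑ k : Fin N, (1 / N : ℂ) * ψ (((k : ℕ) : ℝ) / N) (((l : ℕ) : ℝ) / N)‖ ≤ ε / 3 := fun l =>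
    norm_integral_sub_riemannSum_le (hψs _).continuousOn hN0 fun s hs t ht h =>
      hosc s hs t ht _ (hmem l) _ (hmem l) h (by simp)
  refine ⟨∑ l : Fin N, (1 / N : ℂ) * ∑ k : Fin N,
    (1 / N : ℂ) * ψ (((k : ℕ) : ℝ) / N) (((l : ℕ) : ℝ) / N), ?_, ?_⟩
  · have hp := hpos N (fun k => p (((k : ℕ) : ℝ) / N)) fun k => hpm _
    have he : (∑ l : Fin N, (1 / N : ℂ) * ∑ k : Fin N,
        (1 / N : ℂ) * ψ (((k : ℕ) : ℝ) / N) (((l : ℕ) : ℝ) / N)) =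
        ((1 / N * (1 / N) : ℝ) : ℂ) * ∑ k : Fin N, ∑ l : Fin N,
          φ (p (((k : ℕ) : ℝ) / N)) (p (((l : ℕ) : ℝ) / N)) := by
      rw [Finset.sum_comm, Finset.mul_sum]
      refine Finset.sum_congr rfl fun l _ => ?_
      rw [← Finset.mul_sum, ← mul_assoc]
      push_cast
      rfl
    rw [mem_Ici, he]
    refine mul_nonneg ?_ hp
    rw [Complex.zero_le_real]
    positivity
  · rw [dist_eq_norm]
    have h3 : ‖∑ l : Fin N, (1 / N : ℂ) * (∫ s in (0 : ℝ)..1, ψ s (((l : ℕ) : ℝ) / N)) -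
        ∑ l : Fin N, (1 / N : ℂ) * ∑ k : Fin N,
          (1 / N : ℂ) * ψ (((k : ℕ) : ℝ) / N) (((l : ℕ) : ℝ) / N)‖ ≤ ε / 3 := by
      rw [← Finset.sum_sub_distrib]
      refine (norm_sum_le _ _).trans ?_
      have : ∀ l ∈ (Finset.univ : Finset (Fin N)),
          ‖(1 / N : ℂ) * (∫ s in (0 : ℝ)..1, ψ s (((l : ℕ) : ℝ) / N)) - (1 / N : ℂ) *
            ∑ k : Fin N, (1 / N : ℂ) * ψ (((k : ℕ) : ℝ) / N) (((l : ℕ) : ℝ) / N)‖ ≤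
          1 / N * (ε / 3) := fun l _ => by
        rw [← mul_sub, norm_mul]
        refine mul_le_mul ?_ (h2 l) (norm_nonneg _) (by positivity)
        simp
      refine (Finset.sum_le_sum this).trans (le_of_eq ?_)
      simp only [Finset.sum_const, Finset.card_univ, Fintype.card_fin, nsmul_eq_mul]
      field_simp
    calc _ ≤ ε / 3 + ε / 3 := norm_sub_le_norm_sub_add_norm_sub _ _ _ |>.trans (add_le_add h1 h3)
      _ < ε := by linarith

end RiemannSums

/-! ### Polarization and mixed logarithmic derivatives. -/

section MixedDerivatives

theorem differentiableOn_div {E : Type*} [NormedAddCommGroup E] [NormedSpace ℂ E] {f g : E → ℂ}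
    {U : Set E} (hf : DifferentiableOn ℂ f U) (hg : DifferentiableOn ℂ g U)
    (h0 : ∀ x ∈ U, g x ≠ 0) : DifferentiableOn ℂ (fun x => f x / g x) U := by
  simp only [div_eq_mul_inv]
  exact hf.mul fun x hx => (differentiableAt_inv (h0 x hx)).comp_differentiableWithinAt x (hg x hx)

variable {m : ℕ}

theorem polydisc_eq_ball : polydisc m = ball 0 1 := by
  ext z
  simp [polydisc, pi_norm_lt_iff]

theorem isOpen_polydisc : IsOpen (polydisc m) := polydisc_eq_ball ▸ isOpen_ball

theorem star_mem_polydisc {z : Fin m → ℂ} : star z ∈ polydisc m ↔ z ∈ polydisc m := by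
  simp [polydisc]

theorem mk_mem_ball_iff {z v : Fin m → ℂ} {r : ℝ} :
    ((z, v) : (Fin m → ℂ) × (Fin m → ℂ)) ∈ ball 0 r ↔ ‖z‖ < r ∧ ‖v‖ < r := by
  simp [Prod.norm_def]

theorem mem_ball_one_iff {p : (Fin m → ℂ) × (Fin m → ℂ)} :
    p ∈ ball 0 1 ↔ p.1 ∈ polydisc m ∧ star p.2 ∈ polydisc m := by
  rw [polydisc_eq_ball]
  simp [Prod.norm_def]

theorem isSesquiholomorphicOn_polydisc {F : (Fin m → ℂ) → (Fin m → ℂ) → ℂ} :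
    IsSesquiholomorphicOn (polydisc m) F ↔
      DifferentiableOn ℂ (fun p : (Fin m → ℂ) × (Fin m → ℂ) => F p.1 (star p.2)) (ball 0 1) := by
  have : {p : (Fin m → ℂ) × (Fin m → ℂ) | p.1 ∈ polydisc m ∧ star p.2 ∈ polydisc m} =
      ball 0 1 := by
    ext p; exact mem_ball_one_iff.symm
  rw [IsSesquiholomorphicOn, this]

/-- A holomorphic function of `(z, v)` that vanishes for `v = conj z` is zero. -/
theorem eqOn_zero_of_diagonal {f : (Fin m → ℂ) × (Fin m → ℂ) → ℂ} {r : ℝ}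
    (hf : DifferentiableOn ℂ f (ball 0 r)) (h : ∀ w, ‖w‖ < r → f (w, star w) = 0) :
    EqOn f 0 (ball 0 r) := by
  rintro ⟨z, v⟩ hp
  obtain ⟨hz, hv⟩ := mk_mem_ball_iff.1 hp
  -- With z = a + ib and v = ā + i b̄, the complex line τ ↦ (a + τb, ā + τb̄) lies on the diagonal v
  -- = z̄ for real τ and reaches the given point at τ = i. Vanishing at real τ near 0 propagates
  -- along the line.
  set a : Fin m → ℂ := (2⁻¹ : ℂ) • (z + star v) with ha
  set b : Fin m → ℂ := (-Complex.I * 2⁻¹) • (z - star v) with hb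
  have har : ‖a‖ < r := by
    rw [ha, norm_smul]
    have := norm_add_le z (star v)
    rw [norm_star] at this
    simp only [norm_inv, Complex.norm_ofNat]
    linarith
  have hsa : star a = (2⁻¹ : ℂ) • (v + star z) := by
    rw [ha, star_smul, star_add, star_star, add_comm]; simp
  have hsb : star b = (Complex.I * 2⁻¹) • (star z - v) := by
    rw [hb, star_smul, star_sub, star_star]; simp
  let l : ℂ → (Fin m → ℂ) × (Fin m → ℂ) := fun τ => (a, star a) + τ • (b, star b)
  have hl : Differentiable ℂ l := by fun_prop
  set V : Set ℂ := l ⁻¹' ball 0 r with hV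
  have hVo : IsOpen V := isOpen_ball.preimage hl.continuous
  have hVc : Convex ℝ V := by
    intro τ hτ σ hσ α β hα hβ hαβ
    have := convex_ball (0 : (Fin m → ℂ) × (Fin m → ℂ)) r hτ hσ hα hβ hαβ
    have he : l (α • τ + β • σ) = α • l τ + β • l σ := by
      have h1 : α • l τ + β • l σ = (α + β) • (a, star a) + (α • τ + β • σ) • (b, star b) := by
        simp only [l, smul_add, add_smul, smul_assoc]
        abel
      rw [h1, hαβ, one_smul]
    rw [hV, mem_preimage, he]
    exact this
  have h0 : (0 : ℂ) ∈ V := by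
    simp only [hV, mem_preimage, l, zero_smul, add_zero]
    exact mk_mem_ball_iff.2 ⟨har, by rwa [norm_star]⟩
  have hl1 : l Complex.I = (z, v) := by
    simp only [l, Prod.smul_mk, Prod.mk_add_mk, hsa, hsb]
    simp only [ha, hb, smul_smul]
    refine Prod.ext ?_ ?_
    · ext i
      simp only [Pi.add_apply, Pi.smul_apply, Pi.sub_apply, smul_eq_mul]
      linear_combination (-(1 / 2) * (z i - star v i)) * Complex.I_mul_I
    · ext i
      simp only [Pi.add_apply, Pi.smul_apply, Pi.sub_apply, smul_eq_mul]
      linear_combination ((1 / 2) * (star z i - v i)) * Complex.I_mul_I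
  have han : AnalyticOnNhd ℂ (f ∘ l) V :=
    (hf.comp hl.differentiableOn fun _ h => h).analyticOnNhd hVo
  have hreal : ∀ t : ℝ, (t : ℂ) ∈ V → (f ∘ l) t = 0 := by
    intro t ht
    have he : l t = (a + (t : ℂ) • b, star (a + (t : ℂ) • b)) := by
      simp [l, star_smul]
    simp only [hV, mem_preimage, he] at ht
    rw [Function.comp_apply, he]
    exact h _ (mk_mem_ball_iff.1 ht).1
  have hfreq : ∃ᶠ τ in 𝓝[≠] (0 : ℂ), (f ∘ l) τ = 0 := by
    have ht : Tendsto (fun t : ℝ => (t : ℂ)) (𝓝[≠] 0) (𝓝[≠] 0) := by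
      refine tendsto_nhdsWithin_iff.2 ⟨?_, ?_⟩
      · exact (Complex.continuous_ofReal.tendsto' 0 0 (by simp)).mono_left nhdsWithin_le_nhds
      · filter_upwards [self_mem_nhdsWithin] with t ht
        simpa using ht
    refine ht.frequently (Eventually.frequently ?_)
    have := ht.eventually (nhdsWithin_le_nhds (hVo.mem_nhds h0))
    filter_upwards [this] with t ht
    exact hreal t ht
  have := han.eqOn_zero_of_preconnected_of_frequently_eq_zero hVc.isPreconnected h0 hfreq
    (show Complex.I ∈ V by rw [hV, mem_preimage, hl1]; exact hp)
  simpa [hl1] using this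

/-- The coordinate vector of `z_i` in the space of pairs `(z, v)`. -/
def eL (i : Fin m) : (Fin m → ℂ) × (Fin m → ℂ) := (Pi.single i 1, 0)

/-- The coordinate vector of `v_j` in the space of pairs `(z, v)`. -/
def eR (j : Fin m) : (Fin m → ℂ) × (Fin m → ℂ) := (0, Pi.single j 1)

/-- The mixed derivative `∂²Φ / ∂z_i ∂v_j`. -/
def mixed (i j : Fin m) (Φ : (Fin m → ℂ) × (Fin m → ℂ) → ℂ)
    (p : (Fin m → ℂ) × (Fin m → ℂ)) : ℂ :=
  fderiv ℂ (fun q => fderiv ℂ Φ q (eR j)) p (eL i)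

/-- The mixed derivative `∂² log Q / ∂z_i ∂v_j`, expressed without a logarithm. -/
def mixedLog (i j : Fin m) (Q : (Fin m → ℂ) × (Fin m → ℂ) → ℂ)
    (p : (Fin m → ℂ) × (Fin m → ℂ)) : ℂ :=
  fderiv ℂ (fun q => fderiv ℂ Q q (eR j) / Q q) p (eL i)

theorem differentiableOn_mixed {U : Set ((Fin m → ℂ) × (Fin m → ℂ))} (hU : IsOpen U)
    {Φ : (Fin m → ℂ) × (Fin m → ℂ) → ℂ} (hΦ : DifferentiableOn ℂ Φ U) (i j : Fin m) :
    DifferentiableOn ℂ (mixed i j Φ) U :=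
  differentiableOn_fderiv_apply hU (differentiableOn_fderiv_apply hU hΦ _) _

theorem mixedLog_congr {Q R : (Fin m → ℂ) × (Fin m → ℂ) → ℂ} {p : (Fin m → ℂ) × (Fin m → ℂ)}
    (h : Q =ᶠ[𝓝 p] R) (i j : Fin m) : mixedLog i j Q p = mixedLog i j R p := by
  have : (fun q => fderiv ℂ Q q (eR j) / Q q) =ᶠ[𝓝 p] fun q => fderiv ℂ R q (eR j) / R q := by
    filter_upwards [eventually_eventually_nhds.2 h] with q hq
    rw [EventuallyEq.fderiv_eq hq, Eventually.self_of_nhds hq]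
  rw [mixedLog, mixedLog, this.fderiv_eq]

theorem mixedLog_eq_mixed {U : Set ((Fin m → ℂ) × (Fin m → ℂ))} (hU : IsOpen U)
    {L Q : (Fin m → ℂ) × (Fin m → ℂ) → ℂ} (hL : DifferentiableOn ℂ L U)
    (hQ : ∀ p ∈ U, Complex.exp (L p) = Q p) {p : (Fin m → ℂ) × (Fin m → ℂ)} (hp : p ∈ U)
    (i j : Fin m) : mixedLog i j Q p = mixed i j L p := by
  have h1 : Q =ᶠ[𝓝 p] fun q => Complex.exp (L q) := by
    filter_upwards [hU.mem_nhds hp] with q hq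
    exact (hQ q hq).symm
  rw [mixedLog_congr h1]
  have : (fun q => fderiv ℂ (fun q => Complex.exp (L q)) q (eR j) / Complex.exp (L q)) =ᶠ[𝓝 p]
      fun q => fderiv ℂ L q (eR j) := by
    filter_upwards [hU.mem_nhds hp] with q hq
    have := (hL.differentiableAt (hU.mem_nhds hq)).hasFDerivAt.cexp
    rw [this.fderiv]
    simp [mul_div_cancel_left₀ _ (Complex.exp_ne_zero (L q))]
  rw [mixedLog, mixed, this.fderiv_eq]

/-- Logarithmic derivatives are additive on products, so no common branch of logarithm is involved.
-/
theorem mixedLog_mul {Q R : (Fin m → ℂ) × (Fin m → ℂ) → ℂ}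
    {U : Set ((Fin m → ℂ) × (Fin m → ℂ))} (hU : IsOpen U)
    (hQ : DifferentiableOn ℂ Q U) (hR : DifferentiableOn ℂ R U) (hQ0 : ∀ p ∈ U, Q p ≠ 0)
    (hR0 : ∀ p ∈ U, R p ≠ 0) {p : (Fin m → ℂ) × (Fin m → ℂ)} (hp : p ∈ U) (i j : Fin m) :
    mixedLog i j (fun q => Q q * R q) p = mixedLog i j Q p + mixedLog i j R p := by
  have h : (fun q => fderiv ℂ (fun q => Q q * R q) q (eR j) / (Q q * R q)) =ᶠ[𝓝 p]
      fun q => fderiv ℂ Q q (eR j) / Q q + fderiv ℂ R q (eR j) / R q := by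
    filter_upwards [hU.mem_nhds hp] with q hq
    have h1 := hQ.differentiableAt (hU.mem_nhds hq)
    have h2 := hR.differentiableAt (hU.mem_nhds hq)
    have h3 := hQ0 q hq
    have h4 := hR0 q hq
    rw [fderiv_fun_mul h1 h2]
    simp only [add_apply, smul_apply, smul_eq_mul]
    field_simp
    ring
  rw [mixedLog, h.fderiv_eq, fderiv_fun_add]
  · rfl
  · exact (differentiableOn_div (differentiableOn_fderiv_apply hU hQ _) hQ hQ0).differentiableAt
      (hU.mem_nhds hp)
  · exact (differentiableOn_div (differentiableOn_fderiv_apply hU hR _) hR hR0).differentiableAt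
      (hU.mem_nhds hp)

theorem fderiv_apply_eq_zero_of_invariant {E : Type*} [NormedAddCommGroup E] [NormedSpace ℂ E]
    {f : E → ℂ} {p v : E} (h : ∀ τ : ℂ, f (p + τ • v) = f p) : fderiv ℂ f p v = 0 := by
  by_cases hf : DifferentiableAt ℂ f p
  · have h2 : HasDerivAt (fun τ : ℂ => p + τ • v) v 0 := by
      simpa using ((hasDerivAt_id (0 : ℂ)).smul_const v).const_add p
    have h1 : HasFDerivAt f (fderiv ℂ f p) (p + (0 : ℂ) • v) := by simpa using hf.hasFDerivAt
    have h3 := h1.comp_hasDerivAt (0 : ℂ) h2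
    have h4 : (f ∘ fun τ : ℂ => p + τ • v) = fun _ => f p := funext h
    rw [h4] at h3
    exact h3.unique (hasDerivAt_const _ _)
  · simp [fderiv_zero_of_not_differentiableAt hf]

/-- Changing the section by a factor c multiplies the polarized squared norm by a function of z and
a function of v. That both are invisible to the mixed derivative is why the curvature does not
depend on the section. No regularity of c is needed: the derivative along a direction of invariance
is 0, also by its default value. -/
theorem mixedLog_comp_fst (c : (Fin m → ℂ) → ℂ) (p : (Fin m → ℂ) × (Fin m → ℂ)) (i j : Fin m) :
    mixedLog i j (fun q => c q.1) p = 0 := by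
  have : (fun q : (Fin m → ℂ) × (Fin m → ℂ) => fderiv ℂ (fun q => c q.1) q (eR j) / c q.1) =
      fun _ => 0 := by
    funext q
    rw [fderiv_apply_eq_zero_of_invariant (fun τ => by simp [eR]), zero_div]
  simp [mixedLog, this]

theorem mixedLog_comp_snd (d : (Fin m → ℂ) → ℂ) (p : (Fin m → ℂ) × (Fin m → ℂ)) (i j : Fin m) :
    mixedLog i j (fun q => d q.2) p = 0 := by
  refine fderiv_apply_eq_zero_of_invariant fun τ => ?_
  have : fderiv ℂ (fun q : (Fin m → ℂ) × (Fin m → ℂ) => d q.2) (p + τ • eL i) =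
      fderiv ℂ (fun q : (Fin m → ℂ) × (Fin m → ℂ) => d q.2) p := by
    rw [← fderiv_comp_add_right (τ • eL i)]
    simp [eL]
  rw [this]
  simp [eL]

/-- The quotient rule gives Q''(b, a)/Q - Q'(a)Q'(b)/Q², which is symmetric because the second
derivative is. -/
theorem fderiv_logDeriv_symm {E : Type*} [NormedAddCommGroup E] [NormedSpace ℂ E]
    [FiniteDimensional ℂ E] {Q : E → ℂ} {U : Set E} (hU : IsOpen U)
    (hQ : DifferentiableOn ℂ Q U) (hQ0 : ∀ p ∈ U, Q p ≠ 0) {p : E} (hp : p ∈ U) (a b : E) :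
    fderiv ℂ (fun q => fderiv ℂ Q q a / Q q) p b = fderiv ℂ (fun q => fderiv ℂ Q q b / Q q) p a := by
  have hd2 := (differentiableOn_fderiv hU hQ).differentiableAt (hU.mem_nhds hp)
  have hd1 := hQ.differentiableAt (hU.mem_nhds hp)
  have key : ∀ a b : E, fderiv ℂ (fun q => fderiv ℂ Q q a / Q q) p b =
      fderiv ℂ (fderiv ℂ Q) p b a * (Q p)⁻¹ - fderiv ℂ Q p a * fderiv ℂ Q p b * (Q p ^ 2)⁻¹ := by
    intro a b
    have h1 : HasFDerivAt (fun q => fderiv ℂ Q q a)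
        ((ContinuousLinearMap.apply ℂ ℂ a).comp (fderiv ℂ (fderiv ℂ Q) p)) p :=
      (ContinuousLinearMap.apply ℂ ℂ a).hasFDerivAt.comp p hd2.hasFDerivAt
    have h2 := (hasDerivAt_inv (hQ0 p hp)).comp_hasFDerivAt p hd1.hasFDerivAt
    have h3 := h1.mul h2
    have h4 : (fun q => fderiv ℂ Q q a / Q q) =
        (fun q => fderiv ℂ Q q a) * (fun x => x⁻¹) ∘ Q := by
      funext q; simp [div_eq_mul_inv]
    rw [h4, h3.fderiv]
    simp
    ring
  have hsymm := second_derivative_symmetric_of_eventually (f := Q) (f' := fderiv ℂ Q)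
    (f'' := fderiv ℂ (fderiv ℂ Q) p) (x := p) (by
      filter_upwards [hU.mem_nhds hp] with q hq
      exact (hQ.differentiableAt (hU.mem_nhds hq)).hasFDerivAt) hd2.hasFDerivAt a b
  rw [key, key, hsymm]
  ring

/-- The mixed derivatives are symmetric under the exchange of the two variables. -/
theorem mixedLog_comp_swap {Q : (Fin m → ℂ) × (Fin m → ℂ) → ℂ}
    {U : Set ((Fin m → ℂ) × (Fin m → ℂ))} (hU : IsOpen U)
    (hQ : DifferentiableOn ℂ Q U) (hQ0 : ∀ p ∈ U, Q p ≠ 0)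
    {z v : Fin m → ℂ} (hp : (v, z) ∈ U) (i j : Fin m) :
    mixedLog i j (fun q => Q q.swap) (z, v) = mixedLog j i Q (v, z) := by
  let e := ContinuousLinearEquiv.prodComm ℂ (Fin m → ℂ) (Fin m → ℂ)
  have he : ∀ (f : (Fin m → ℂ) × (Fin m → ℂ) → ℂ) (q x : (Fin m → ℂ) × (Fin m → ℂ)),
      fderiv ℂ (fun q => f q.swap) q x = fderiv ℂ f q.swap x.swap := fun f q x => by
    have := e.comp_right_fderiv (f := f) (x := q)
    have h2 : (f ∘ e) = fun q => f q.swap := rfl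
    rw [h2] at this
    rw [this]
    rfl
  have h1 : (fun q => fderiv ℂ (fun q => Q q.swap) q (eR j) / Q q.swap) =
      fun q => (fun q => fderiv ℂ Q q (eL j) / Q q) q.swap := by
    funext q
    rw [he]
    rfl
  rw [mixedLog, h1, he (fun q => fderiv ℂ Q q (eL j) / Q q)]
  exact fderiv_logDeriv_symm hU hQ hQ0 hp (eL j) (eR i)

end MixedDerivatives

/-! ### The complex Hessian as a mixed holomorphic derivative on the diagonal. -/

section Hessian

variable {m : ℕ}

/-- The real-linear map z ↦ (z, z̄) sends the directions 1 and i of the i-th coordinate to e_L + e_R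
and i(e_L - e_R). The two Wirtinger combinations separate e_L from e_R. -/
theorem wirtinger_comp_diagonal {Φ : (Fin m → ℂ) × (Fin m → ℂ) → ℂ} {w : Fin m → ℂ}
    (hΦ : DifferentiableAt ℂ Φ (w, star w)) (i : Fin m) :
    wirtinger i (fun z => Φ (z, star z)) w = fderiv ℂ Φ (w, star w) (eL i) ∧
    wirtingerBar i (fun z => Φ (z, star z)) w = fderiv ℂ Φ (w, star w) (eR i) := by
  let D : (Fin m → ℂ) →L[ℝ] (Fin m → ℂ) × (Fin m → ℂ) :=
    (ContinuousLinearMap.id ℝ _).prod (starL' ℝ : (Fin m → ℂ) ≃L[ℝ] (Fin m → ℂ)).toContinuousLinearMap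
  have hD : ∀ z, D z = (z, star z) := fun z => rfl
  have h1 : HasFDerivAt (𝕜 := ℝ) Φ ((fderiv ℂ Φ (w, star w)).restrictScalars ℝ) (D w) :=
    hΦ.hasFDerivAt.restrictScalars ℝ
  have h2 : HasFDerivAt (𝕜 := ℝ) (fun z => Φ (z, star z))
    (((fderiv ℂ Φ (w, star w)).restrictScalars ℝ).comp D) w := h1.comp w D.hasFDerivAt
  set A := fderiv ℂ Φ (w, star w) with hA
  have e1 : D (Pi.single i 1) = eL i + eR i := by
    simp [hD, eL, eR]
  have e2 : D (Pi.single i Complex.I) = Complex.I • eL i - Complex.I • eR i := by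
    rw [hD, ← Pi.single_star]
    simp [eL, eR, ← Pi.single_smul, ← Pi.single_neg]
  have e3 : fderiv ℝ (fun z => Φ (z, star z)) w (Pi.single i 1) = A (eL i) + A (eR i) := by
    rw [h2.fderiv]
    simp only [ContinuousLinearMap.comp_apply, e1, ContinuousLinearMap.coe_restrictScalars',
      map_add]
  have e4 : fderiv ℝ (fun z => Φ (z, star z)) w (Pi.single i Complex.I) =
      Complex.I * A (eL i) - Complex.I * A (eR i) := by
    rw [h2.fderiv]
    simp only [ContinuousLinearMap.comp_apply, e2, ContinuousLinearMap.coe_restrictScalars',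
      map_sub, map_smul, smul_eq_mul]
  rw [wirtinger, wirtingerBar, e3, e4]
  constructor
  · linear_combination (-(1 / 2) * (A (eL i) - A (eR i))) * Complex.I_mul_I
  · linear_combination ((1 / 2) * (A (eL i) - A (eR i))) * Complex.I_mul_I

theorem complexHessian_eq_mixed {Φ : (Fin m → ℂ) × (Fin m → ℂ) → ℂ}
    {U : Set ((Fin m → ℂ) × (Fin m → ℂ))} (hU : IsOpen U) (hΦ : DifferentiableOn ℂ Φ U)
    {w : Fin m → ℂ} (hw : (w, star w) ∈ U) {u : (Fin m → ℂ) → ℝ}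
    (hu : ∀ᶠ z in 𝓝 w, (u z : ℂ) = Φ (z, star z)) (i j : Fin m) :
    complexHessian u w i j = mixed i j Φ (w, star w) := by
  have hc : Continuous fun z : Fin m → ℂ => (z, star z) := by fun_prop
  have hUe : ∀ᶠ z in 𝓝 w, (z, star z) ∈ U := hc.continuousAt.eventually (hU.mem_nhds hw)
  have h1 : wirtingerBar j (fun z => (u z : ℂ)) =ᶠ[𝓝 w]
      fun z => fderiv ℂ Φ (z, star z) (eR j) := by
    filter_upwards [eventually_eventually_nhds.2 hu, hUe] with z hz hzU
    rw [← (wirtinger_comp_diagonal (hΦ.differentiableAt (hU.mem_nhds hzU)) j).2]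
    have : (fun z => (u z : ℂ)) =ᶠ[𝓝 z] fun z => Φ (z, star z) := hz
    rw [wirtingerBar, this.fderiv_eq]
    rfl
  rw [complexHessian, Matrix.of_apply, wirtinger, h1.fderiv_eq]
  exact (wirtinger_comp_diagonal (Φ := fun q => fderiv ℂ Φ q (eR j))
    ((differentiableOn_fderiv_apply hU hΦ _).differentiableAt (hU.mem_nhds hw)) i).1

theorem complexHessian_eq_mixedLog {Q : (Fin m → ℂ) × (Fin m → ℂ) → ℂ}
    {U : Set ((Fin m → ℂ) × (Fin m → ℂ))} (hU : IsOpen U) (hQ : DifferentiableOn ℂ Q U)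
    {w : Fin m → ℂ} (hw : (w, star w) ∈ U) {u : (Fin m → ℂ) → ℝ}
    (hu : ∀ᶠ z in 𝓝 w, 0 < Q (z, star z) ∧ u z = Real.log (Q (z, star z)).re) (i j : Fin m) :
    complexHessian u w i j = mixedLog i j Q (w, star w) := by
  -- The principal logarithm of Q is holomorphic here; positivity of Q on the diagonal puts the base
  -- point inside.
  set V := U ∩ Q ⁻¹' Complex.slitPlane with hV
  have hVo : IsOpen V := hQ.continuousOn.isOpen_inter_preimage hU Complex.isOpen_slitPlane
  have hL : DifferentiableOn ℂ (fun p => Complex.log (Q p)) V := fun p hp =>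
    (((hQ.differentiableAt (hU.mem_nhds hp.1)).clog hp.2)).differentiableWithinAt
  have hslit : ∀ {x : ℂ}, 0 < x → x ∈ Complex.slitPlane := fun hx => Or.inl (Complex.lt_def.1 hx).1
  have hwV : (w, star w) ∈ V := ⟨hw, hslit hu.self_of_nhds.1⟩
  rw [mixedLog_eq_mixed hVo hL (fun p hp => Complex.exp_log (Complex.slitPlane_ne_zero hp.2)) hwV]
  refine complexHessian_eq_mixed hVo hL hwV ?_ i j
  filter_upwards [hu] with z hz
  obtain ⟨hre, him⟩ := Complex.lt_def.1 hz.1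
  rw [hz.2, Complex.ofReal_log (by simpa using hre.le)]
  congr 1
  exact Complex.ext rfl (by simpa using him)

end Hessian

/-! ### Second differences and mixed derivatives. -/

section SecondDifferences

theorem integral_fderiv_line {E : Type*} [NormedAddCommGroup E] [NormedSpace ℂ E]
    [FiniteDimensional ℂ E] {f : E → ℂ} {U : Set E} (hU : IsOpen U) (hf : DifferentiableOn ℂ f U)
    {p v : E} (h : ∀ s ∈ Icc (0 : ℝ) 1, p + (s : ℂ) • v ∈ U) :
    ∫ s in (0 : ℝ)..1, fderiv ℂ f (p + (s : ℂ) • v) v = f (p + v) - f p := by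
  have hc : Continuous fun s : ℝ => p + (s : ℂ) • v := by fun_prop
  have := intervalIntegral.integral_eq_sub_of_hasDerivAt (a := 0) (b := 1)
    (f := fun s : ℝ => f (p + (s : ℂ) • v))
    (f' := fun s : ℝ => fderiv ℂ f (p + (s : ℂ) • v) v) (fun s hs => ?_) ?_
  · simpa using this
  · rw [uIcc_of_le zero_le_one] at hs
    have h1 := (hf.differentiableAt (hU.mem_nhds (h s hs))).hasFDerivAt
    have h2 : HasDerivAt (fun τ : ℂ => p + τ • v) v (s : ℂ) := by
      simpa using ((hasDerivAt_id (s : ℂ)).smul_const v).const_add p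
    exact (h1.comp_hasDerivAt (s : ℂ) h2).comp_ofReal
  · refine ContinuousOn.intervalIntegrable ?_
    rw [uIcc_of_le zero_le_one]
    exact (differentiableOn_fderiv_apply hU hf v).continuousOn.comp hc.continuousOn h

variable {m : ℕ}

/-- The fundamental theorem of calculus, once in each variable. It serves for small increments, in
the limit of difference quotients, and from the origin, where it identifies the potential. -/
theorem second_difference_eq_integral {Φ : (Fin m → ℂ) × (Fin m → ℂ) → ℂ}
    {U : Set ((Fin m → ℂ) × (Fin m → ℂ))} (hU : IsOpen U) (hΦ : DifferentiableOn ℂ Φ U)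
    {a b z v : Fin m → ℂ}
    (h : ∀ s ∈ Icc (0 : ℝ) 1, ∀ t ∈ Icc (0 : ℝ) 1, (a + (s : ℂ) • z, b + (t : ℂ) • v) ∈ U) :
    Φ (a + z, b + v) - Φ (a + z, b) - Φ (a, b + v) + Φ (a, b) =
      ∫ t in (0 : ℝ)..1, ∫ s in (0 : ℝ)..1,
        ∑ i, ∑ j, z i * v j * mixed i j Φ (a + (s : ℂ) • z, b + (t : ℂ) • v) := by
  have h0 : (0 : ℝ) ∈ Icc (0 : ℝ) 1 := by simp
  have h1 : (1 : ℝ) ∈ Icc (0 : ℝ) 1 := by simp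
  set ψ : (Fin m → ℂ) × (Fin m → ℂ) → ℂ := fun q => fderiv ℂ Φ q (0, v) with hψ
  have hψd : DifferentiableOn ℂ ψ U := differentiableOn_fderiv_apply hU hΦ _
  have hsum : ∀ p ∈ U, fderiv ℂ ψ p (z, 0) = ∑ i, ∑ j, z i * v j * mixed i j Φ p := by
    intro p hp
    have e1 : ((0, v) : (Fin m → ℂ) × (Fin m → ℂ)) = ∑ j, v j • eR j := by
      refine Prod.ext (by simp [eR, Prod.fst_sum]) ?_
      simp only [eR, Prod.snd_sum, Prod.smul_mk]
      exact pi_eq_sum_univ' v |>.trans (by simp)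
    have e2 : ((z, 0) : (Fin m → ℂ) × (Fin m → ℂ)) = ∑ i, z i • eL i := by
      refine Prod.ext ?_ (by simp [eL, Prod.snd_sum])
      simp only [eL, Prod.fst_sum, Prod.smul_mk]
      exact pi_eq_sum_univ' z |>.trans (by simp)
    have e3 : ψ = fun q => ∑ j, v j * fderiv ℂ Φ q (eR j) := by
      funext q
      simp only [hψ]
      rw [e1]
      simp
    rw [e2, map_sum]
    refine Finset.sum_congr rfl fun i _ => ?_
    rw [map_smul, e3, fderiv_fun_sum fun j _ => ((differentiableOn_fderiv_apply hU hΦ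
      (eR j)).differentiableAt (hU.mem_nhds hp)).const_mul _]
    simp only [sum_apply, smul_eq_mul, Finset.mul_sum, mixed]
    refine Finset.sum_congr rfl fun j _ => ?_
    rw [fderiv_const_mul ((differentiableOn_fderiv_apply hU hΦ
      (eR j)).differentiableAt (hU.mem_nhds hp))]
    simp [mul_assoc]
  have hin : ∀ t ∈ Icc (0 : ℝ) 1, (∫ s in (0 : ℝ)..1,
      ∑ i, ∑ j, z i * v j * mixed i j Φ (a + (s : ℂ) • z, b + (t : ℂ) • v)) =
      ψ (a + z, b + (t : ℂ) • v) - ψ (a, b + (t : ℂ) • v) := by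
    intro t ht
    have := integral_fderiv_line hU hψd (p := (a, b + (t : ℂ) • v)) (v := (z, 0))
      (fun s hs => by simpa using h s hs t ht)
    simp only [Prod.smul_mk, smul_zero, Prod.mk_add_mk, add_zero] at this
    rw [← this]
    refine intervalIntegral.integral_congr fun s hs => ?_
    rw [uIcc_of_le zero_le_one] at hs
    exact (hsum _ (h s hs t ht)).symm
  have hcont : ∀ c, (∀ t ∈ Icc (0 : ℝ) 1, (c, b + (t : ℂ) • v) ∈ U) →
      IntervalIntegrable (fun t : ℝ => ψ (c, b + (t : ℂ) • v)) volume 0 1 := fun c hc => by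
    refine ContinuousOn.intervalIntegrable ?_
    rw [uIcc_of_le zero_le_one]
    have : Continuous fun t : ℝ => (c, b + (t : ℂ) • v) := by fun_prop
    exact hψd.continuousOn.comp this.continuousOn hc
  have hU1 : ∀ t ∈ Icc (0 : ℝ) 1, (a + z, b + (t : ℂ) • v) ∈ U := fun t ht => by
    simpa using h 1 h1 t ht
  have hU0 : ∀ t ∈ Icc (0 : ℝ) 1, (a, b + (t : ℂ) • v) ∈ U := fun t ht => by
    simpa using h 0 h0 t ht
  have hout : ∀ c, (∀ t ∈ Icc (0 : ℝ) 1, (c, b + (t : ℂ) • v) ∈ U) →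
      ∫ t in (0 : ℝ)..1, ψ (c, b + (t : ℂ) • v) = Φ (c, b + v) - Φ (c, b) := fun c hc => by
    have := integral_fderiv_line hU hΦ (p := (c, b)) (v := (0, v))
      (fun t ht => by simpa using hc t ht)
    simpa using this
  have hcongr : (∫ t in (0 : ℝ)..1, ∫ s in (0 : ℝ)..1,
      ∑ i, ∑ j, z i * v j * mixed i j Φ (a + (s : ℂ) • z, b + (t : ℂ) • v)) =
      ∫ t in (0 : ℝ)..1, (ψ (a + z, b + (t : ℂ) • v) - ψ (a, b + (t : ℂ) • v)) := by
    refine intervalIntegral.integral_congr fun t ht => ?_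
    rw [uIcc_of_le zero_le_one] at ht
    exact hin t ht
  rw [hcongr, intervalIntegral.integral_sub (hcont _ hU1) (hcont _ hU0), hout _ hU1, hout _ hU0]
  ring

/-- The second difference quotients converge to the mixed derivative. -/
theorem tendsto_second_difference {Φ : (Fin m → ℂ) × (Fin m → ℂ) → ℂ}
    {U : Set ((Fin m → ℂ) × (Fin m → ℂ))} (hU : IsOpen U) (hΦ : DifferentiableOn ℂ Φ U)
    {a b : Fin m → ℂ} (hab : (a, b) ∈ U) (i j : Fin m) :
    Tendsto (fun h : ℝ => ((h : ℂ) ^ 2)⁻¹ *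
      (Φ (a + Pi.single i (h : ℂ), b + Pi.single j (h : ℂ)) - Φ (a + Pi.single i (h : ℂ), b) -
        Φ (a, b + Pi.single j (h : ℂ)) + Φ (a, b))) (𝓝[>] 0) (𝓝 (mixed i j Φ (a, b))) := by
  set c := mixed i j Φ (a, b) with hc
  -- Subtracting c z_i v_j makes the mixed derivative vanish at (a, b), so by continuity the second
  -- difference of G is at most h²ε/2.
  set G : (Fin m → ℂ) × (Fin m → ℂ) → ℂ := fun q => Φ q - c * (q.1 i * q.2 j) with hG
  have hGd : DifferentiableOn ℂ G U := by
    refine hΦ.sub (Differentiable.differentiableOn ?_)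
    fun_prop
  have hGm : ∀ p ∈ U, mixed i j G p = mixed i j Φ p - c := by
    intro p hp
    let X : (Fin m → ℂ) × (Fin m → ℂ) →L[ℂ] ℂ :=
      (ContinuousLinearMap.proj i).comp (ContinuousLinearMap.fst ℂ _ _)
    let Y : (Fin m → ℂ) × (Fin m → ℂ) →L[ℂ] ℂ :=
      (ContinuousLinearMap.proj j).comp (ContinuousLinearMap.snd ℂ _ _)
    have h1 : (fun q => fderiv ℂ G q (eR j)) =ᶠ[𝓝 p]
        fun q => fderiv ℂ Φ q (eR j) - c * q.1 i := by
      filter_upwards [hU.mem_nhds hp] with q hq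
      have e1 : HasFDerivAt (fun q : (Fin m → ℂ) × (Fin m → ℂ) => q.1 i)
          X q := X.hasFDerivAt
      have e2 : HasFDerivAt (fun q : (Fin m → ℂ) × (Fin m → ℂ) => q.2 j)
          Y q := Y.hasFDerivAt
      have e3 := ((hΦ.differentiableAt (hU.mem_nhds hq)).hasFDerivAt).sub
        ((e1.mul e2).const_mul c)
      have e4 : G = Φ - fun q => c * ((fun q : (Fin m → ℂ) × (Fin m → ℂ) => q.1 i) *
        fun q : (Fin m → ℂ) × (Fin m → ℂ) => q.2 j) q := rfl
      rw [e4, e3.fderiv]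
      simp [eR, X, Y]
    rw [mixed, h1.fderiv_eq]
    have e1 : HasFDerivAt (fun q : (Fin m → ℂ) × (Fin m → ℂ) => q.1 i)
        X p := X.hasFDerivAt
    have e2 := ((differentiableOn_fderiv_apply hU hΦ (eR j)).differentiableAt
      (hU.mem_nhds hp)).hasFDerivAt.sub (e1.const_mul c)
    have e3 : (fun q => fderiv ℂ Φ q (eR j) - c * q.1 i) =
      (fun q => fderiv ℂ Φ q (eR j)) - fun q : (Fin m → ℂ) × (Fin m → ℂ) => c * q.1 i := rfl
    rw [e3, e2.fderiv]
    simp [eL, mixed, X]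
  rw [Metric.tendsto_nhdsWithin_nhds]
  intro ε hε
  have hcont : ContinuousAt (mixed i j Φ) (a, b) :=
    ((differentiableOn_mixed hU hΦ i j).differentiableAt (hU.mem_nhds hab)).continuousAt
  obtain ⟨δ, hδ, hball⟩ : ∃ δ > 0, ball (a, b) δ ⊆
      U ∩ {p | ‖mixed i j Φ p - c‖ ≤ ε / 2} := by
    refine Metric.mem_nhds_iff.1 (inter_mem (hU.mem_nhds hab) ?_)
    filter_upwards [Metric.continuousAt_iff'.1 hcont (ε / 2) (by positivity)] with p hp
    rw [dist_eq_norm] at hp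
    exact hp.le
  refine ⟨δ, hδ, fun {h} hh hhδ => ?_⟩
  have hh0 : (0 : ℝ) < h := hh
  have hhδ' : h < δ := by simpa [abs_of_pos hh0] using hhδ
  have hmem : ∀ s ∈ Icc (0 : ℝ) 1, ∀ t ∈ Icc (0 : ℝ) 1,
      (a + (s : ℂ) • Pi.single i (h : ℂ), b + (t : ℂ) • Pi.single j (h : ℂ)) ∈ ball (a, b) δ := by
    have hn : ∀ (k : Fin m) (x : Fin m → ℂ), ∀ s ∈ Icc (0 : ℝ) 1,
        dist (x + (s : ℂ) • Pi.single k (h : ℂ)) x < δ := by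
      intro k x s hs
      rw [dist_eq_norm, add_sub_cancel_left, norm_smul, Pi.norm_single, Complex.norm_real,
        Complex.norm_real, Real.norm_of_nonneg hs.1, Real.norm_of_nonneg hh0.le]
      nlinarith [hs.2]
    intro s hs t ht
    rw [mem_ball, Prod.dist_eq]
    exact max_lt (hn _ _ s hs) (hn _ _ t ht)
  have hsd := second_difference_eq_integral hU hGd (a := a) (b := b) (z := Pi.single i (h : ℂ))
    (v := Pi.single j (h : ℂ)) fun s hs t ht => (hball (hmem s hs t ht)).1
  have hbound : ∀ s ∈ Icc (0 : ℝ) 1, ∀ t ∈ Icc (0 : ℝ) 1,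
      ‖∑ i', ∑ j', (Pi.single i (h : ℂ) : Fin m → ℂ) i' * (Pi.single j (h : ℂ) : Fin m → ℂ) j' *
        mixed i' j' G (a + (s : ℂ) • Pi.single i (h : ℂ), b + (t : ℂ) • Pi.single j (h : ℂ))‖ ≤
        h ^ 2 * (ε / 2) := by
    intro s hs t ht
    have hb := hball (hmem s hs t ht)
    rw [Finset.sum_eq_single i (fun i' _ hi' => by simp [hi']) (by simp),
      Finset.sum_eq_single j (fun j' _ hj' => by simp [hj']) (by simp), hGm _ hb.1]
    rw [Pi.single_eq_same, Pi.single_eq_same, norm_mul, norm_mul, Complex.norm_real,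
      Real.norm_of_nonneg hh0.le, ← pow_two]
    exact mul_le_mul_of_nonneg_left hb.2 (by positivity)
  have hI : ∀ s ∈ uIoc (0 : ℝ) 1, s ∈ Icc (0 : ℝ) 1 := fun s hs => by
    rw [uIoc_of_le zero_le_one] at hs
    exact Ioc_subset_Icc_self hs
  have hle := intervalIntegral.norm_integral_le_of_norm_le_const (a := 0) (b := 1)
    (C := h ^ 2 * (ε / 2)) (f := fun t : ℝ => ∫ s in (0 : ℝ)..1,
      ∑ i', ∑ j', (Pi.single i (h : ℂ) : Fin m → ℂ) i' * (Pi.single j (h : ℂ) : Fin m → ℂ) j' *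
        mixed i' j' G (a + (s : ℂ) • Pi.single i (h : ℂ), b + (t : ℂ) • Pi.single j (h : ℂ)))
    (fun t ht => by
      have := intervalIntegral.norm_integral_le_of_norm_le_const (a := 0) (b := 1)
        fun s hs => hbound s (hI s hs) t (hI t ht)
      simpa using this)
  rw [← hsd] at hle
  have hhc : (h : ℂ) ≠ 0 := by exact_mod_cast hh0.ne'
  have heq : ((h : ℂ) ^ 2)⁻¹ *
      (Φ (a + Pi.single i (h : ℂ), b + Pi.single j (h : ℂ)) - Φ (a + Pi.single i (h : ℂ), b) -
        Φ (a, b + Pi.single j (h : ℂ)) + Φ (a, b)) - c = ((h : ℂ) ^ 2)⁻¹ *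
      (G (a + Pi.single i (h : ℂ), b + Pi.single j (h : ℂ)) - G (a + Pi.single i (h : ℂ), b) -
        G (a, b + Pi.single j (h : ℂ)) + G (a, b)) := by
    simp only [hG, Pi.add_apply, Pi.single_eq_same]
    field_simp
    ring
  rw [dist_eq_norm, heq, norm_mul, norm_inv, norm_pow, Complex.norm_real,
    Real.norm_of_nonneg hh0.le, inv_mul_lt_iff₀ (by positivity)]
  rw [sub_zero, abs_one, mul_one] at hle
  refine lt_of_le_of_lt hle ?_
  have : 0 < h ^ 2 := by positivity
  nlinarith

end SecondDifferences

/-! ### From infinite divisibility to positivity of the Hessian. -/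

section FromInfinitelyDivisible

variable {m : ℕ}

theorem tendsto_exp_sub_one_div (c : ℂ) :
    Tendsto (fun t : ℝ => (t : ℂ)⁻¹ * (Complex.exp (t * c) - 1)) (𝓝[>] 0) (𝓝 c) := by
  have h1 : HasDerivAt (fun t : ℂ => Complex.exp (t * c)) c ((0 : ℝ) : ℂ) := by
    have := ((hasDerivAt_id (((0 : ℝ) : ℂ))).mul_const c).cexp
    simpa using this
  have h2 := (hasDerivAt_iff_tendsto_slope_zero.1 h1.comp_ofReal).mono_left
    (nhdsWithin_mono 0 fun t ht => (ne_of_gt ht : t ≠ 0))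
  refine h2.congr fun t => ?_
  simp

/-- The logarithm of an infinitely divisible kernel is conditionally positive definite. -/
theorem sum_nonneg_of_exp {Ω : Set (Fin m → ℂ)} {L : (Fin m → ℂ) → (Fin m → ℂ) → ℂ}
    (hL : ∀ t : ℝ, 0 < t → IsPosDefKernelOn Ω fun z w => Complex.exp (t * L z w))
    {ι : Type*} [Fintype ι] (u : ι → Fin m → ℂ) (hu : ∀ a, u a ∈ Ω) (x : ι → ℂ)
    (hx : ∑ a, x a = 0) : 0 ≤ ∑ a, ∑ b, star (x a) * L (u a) (u b) * x b := by
  have hlim : Tendsto (fun t : ℝ => ∑ a, ∑ b, star (x a) *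
      ((t : ℂ)⁻¹ * (Complex.exp (t * L (u a) (u b)) - 1)) * x b) (𝓝[>] 0)
      (𝓝 (∑ a, ∑ b, star (x a) * L (u a) (u b) * x b)) :=
    tendsto_finsetSum _ fun a _ => tendsto_finsetSum _ fun b _ =>
      ((tendsto_exp_sub_one_div _).const_mul _).mul_const _
  refine ge_of_tendsto hlim ?_
  filter_upwards [self_mem_nhdsWithin] with t ht
  have ht0 : (0 : ℝ) < t := ht
  have h1 := posSemidef_iff_sum_nonneg.1 ((hL t ht0).posSemidef u hu) x
  have h2 : ∑ a, ∑ b, star (x a) * ((t : ℂ)⁻¹ * (Complex.exp (t * L (u a) (u b)) - 1)) * x b =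
      ((t⁻¹ : ℝ) : ℂ) * ∑ a, ∑ b, star (x a) * Complex.exp (t * L (u a) (u b)) * x b := by
    -- The constant 1 subtracted in the difference quotient contributes |∑ x_a|², which is zero.
    have h3 : ∑ a, ∑ b, star (x a) * x b = 0 := by
      simp only [← Finset.mul_sum, hx, mul_zero, Finset.sum_const_zero]
    have h4 : ∑ a, ∑ b, star (x a) * ((t : ℂ)⁻¹ * (Complex.exp (t * L (u a) (u b)) - 1)) * x b =
        (t : ℂ)⁻¹ * (∑ a, ∑ b, star (x a) * Complex.exp (t * L (u a) (u b)) * x b -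
          ∑ a, ∑ b, star (x a) * x b) := by
      simp only [← Finset.sum_sub_distrib, Finset.mul_sum]
      refine Finset.sum_congr rfl fun a _ => Finset.sum_congr rfl fun b _ => ?_
      ring
    rw [h4, h3, sub_zero, Complex.ofReal_inv]
  rw [h2]
  refine mul_nonneg ?_ h1
  rw [Complex.zero_le_real]
  positivity

/-- Conditional positivity of L is applied to the points u_a + h e_i with weights y and the points
u_a with weights -y. The resulting form is the form of second differences; dividing by h² and
letting h → 0 yields the mixed derivatives. -/
theorem isPosDefMatrixKernelOn_mixed {L : (Fin m → ℂ) → (Fin m → ℂ) → ℂ}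
    (hLd : IsSesquiholomorphicOn (polydisc m) L)
    (hL : ∀ t : ℝ, 0 < t → IsPosDefKernelOn (polydisc m) fun z w => Complex.exp (t * L z w)) :
    IsPosDefMatrixKernelOn (polydisc m) fun z w => Matrix.of fun i j =>
      mixed i j (fun p => L p.1 (star p.2)) (z, star w) := by
  intro n u hu
  rw [isSesquiholomorphicOn_polydisc] at hLd
  refine posSemidef_of_tendsto (l := 𝓝[>] (0 : ℝ)) (A := fun h : ℝ => Matrix.of
    fun p q : Fin n × Fin m => ((h : ℂ) ^ 2)⁻¹ *
      (L (u p.1 + Pi.single p.2 (h : ℂ)) (u q.1 + Pi.single q.2 (h : ℂ)) -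
        L (u p.1 + Pi.single p.2 (h : ℂ)) (u q.1) -
        L (u p.1) (u q.1 + Pi.single q.2 (h : ℂ)) + L (u p.1) (u q.1))) ?_ ?_
  · have hmem : ∀ᶠ h : ℝ in 𝓝[>] (0 : ℝ), ∀ p : Fin n × Fin m,
        u p.1 + Pi.single p.2 (h : ℂ) ∈ polydisc m := by
      refine eventually_all.2 fun p => nhdsWithin_le_nhds ?_
      have hc : Continuous fun h : ℝ => u p.1 + Pi.single p.2 (h : ℂ) :=
        continuous_const.add ((continuous_single p.2).comp Complex.continuous_ofReal)
      have := hc.continuousAt (x := 0)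
      refine this.eventually (isOpen_polydisc.mem_nhds ?_)
      simpa using hu p.1
    filter_upwards [hmem, self_mem_nhdsWithin] with h hh h0
    have h0' : (0 : ℝ) < h := h0
    rw [posSemidef_iff_sum_nonneg]
    intro y
    have key := sum_nonneg_of_exp hL (ι := (Fin n × Fin m) ⊕ (Fin n × Fin m))
      (Sum.elim (fun p => u p.1 + Pi.single p.2 (h : ℂ)) fun p => u p.1)
      (by rintro (p | p); exacts [hh p, hu p.1])
      (Sum.elim y fun p => -y p) (by simp [Fintype.sum_sum_type])
    refine (mul_nonneg (a := (((h ^ 2)⁻¹ : ℝ) : ℂ)) ?_ key).trans_eq ?_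
    · rw [Complex.zero_le_real]
      positivity
    · rw [Fintype.sum_sum_type]
      simp only [Fintype.sum_sum_type, Sum.elim_inl, Sum.elim_inr, Matrix.of_apply]
      simp only [← Finset.sum_add_distrib, Finset.mul_sum]
      refine Finset.sum_congr rfl fun p _ => Finset.sum_congr rfl fun q _ => ?_
      simp only [star_neg]
      push_cast
      ring
  · intro p q
    have := tendsto_second_difference isOpen_ball hLd (a := u p.1) (b := star (u q.1))
      (mem_ball_one_iff.2 ⟨hu p.1, by simpa using hu q.1⟩) p.2 q.2
    refine this.congr fun h => ?_
    simp [star_add]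

theorem isPositiveDefiniteFunction_of_isInfinitelyDivisibleOn
    {F : (Fin m → ℂ) → (Fin m → ℂ) → ℂ} (hF : IsInfinitelyDivisibleOn (polydisc m) F) :
    IsPositiveDefiniteFunction (polydisc m) (complexHessian fun w => Real.log (F w w).re) := by
  obtain ⟨L, hLd, hLe, hLr, hL⟩ := hF
  refine ⟨_, fun i j => ?_, fun w hw => ?_, isPosDefMatrixKernelOn_mixed hLd hL⟩
  · rw [isSesquiholomorphicOn_polydisc] at hLd ⊢
    simpa using differentiableOn_mixed isOpen_ball hLd i j
  · rw [isSesquiholomorphicOn_polydisc] at hLd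
    ext i j
    refine (complexHessian_eq_mixed isOpen_ball hLd
      (mem_ball_one_iff.2 ⟨hw, by simpa using hw⟩) ?_ i j).symm
    filter_upwards [isOpen_polydisc.mem_nhds hw] with z hz
    have h1 : L z z = ((L z z).re : ℂ) := Complex.ext rfl (by simpa using hLr z hz)
    simp only [star_star]
    rw [← hLe z hz z hz]
    rw [h1, ← Complex.ofReal_exp, Complex.ofReal_re, Real.log_exp]

end FromInfinitelyDivisible

/-! ### From positivity of the Hessian to infinite divisibility, through a potential. -/

section ToInfinitelyDivisible

variable {m : ℕ}

/-- A non-vanishing holomorphic function on a ball has a holomorphic logarithm. -/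
theorem exists_log_of_ne_zero {E : Type*} [NormedAddCommGroup E] [NormedSpace ℂ E] {f : E → ℂ}
    {r : ℝ} (hr : 0 < r) (hf : DifferentiableOn ℂ f (ball 0 r)) (h0 : ∀ x ∈ ball 0 r, f x ≠ 0) :
    ∃ g : E → ℂ, DifferentiableOn ℂ g (ball 0 r) ∧ ∀ x ∈ ball 0 r, Complex.exp (g x) = f x := by
  let _ : NormedSpace ℝ E := NormedSpace.restrictScalars ℝ ℂ E
  have hsc : IsSimplyConnected (ball (0 : E) r) := by
    have : ContractibleSpace (ball (0 : E) r) :=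
      (convex_ball (0 : E) r).contractibleSpace ⟨0, mem_ball_self hr⟩
    exact (inferInstance : SimplyConnectedSpace (ball (0 : E) r))
  obtain ⟨g, hgc, hg⟩ := Complex.exists_continuousOn_eqOn_exp_comp hsc isOpen_ball
    hf.continuousOn (by rintro ⟨x, hx, hx0⟩; exact h0 x hx hx0)
  refine ⟨g, fun x₀ hx₀ => DifferentiableAt.differentiableWithinAt ?_, fun x hx => hg hx⟩
  have hfx : DifferentiableAt ℂ f x₀ := hf.differentiableAt (isOpen_ball.mem_nhds hx₀)
  -- Simple connectedness only gives a continuous logarithm g. Where |g(x) - g(x₀)| < π it agrees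
  -- with this holomorphic expression.
  have h1 : DifferentiableAt ℂ (fun x => g x₀ + Complex.log (f x * (f x₀)⁻¹)) x₀ := by
    refine ((hfx.mul_const _).clog ?_).const_add _
    simp [h0 x₀ hx₀]
  refine h1.congr_of_eventuallyEq ?_
  have hga : ContinuousAt g x₀ := hgc.continuousAt (isOpen_ball.mem_nhds hx₀)
  have him : ∀ᶠ x in 𝓝 x₀, ‖g x - g x₀‖ < Real.pi := by
    have := Metric.continuousAt_iff'.1 hga Real.pi Real.pi_pos
    simpa [dist_eq_norm] using this
  filter_upwards [him, isOpen_ball.mem_nhds hx₀] with x hx hxb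
  have e1 : f x * (f x₀)⁻¹ = Complex.exp (g x - g x₀) := by
    rw [Complex.exp_sub, div_eq_mul_inv]
    exact congrArg₂ (fun a b => a * b⁻¹) (hg hxb).symm (hg hx₀).symm
  have e2 := (Complex.abs_im_le_norm (g x - g x₀)).trans_lt hx
  rw [abs_lt] at e2
  rw [e1, Complex.log_exp e2.1 e2.2.le]
  ring

theorem differentiableOn_integral_left {f : (Fin m → ℂ) × (Fin m → ℂ) → ℂ}
    (hf : DifferentiableOn ℂ f (ball 0 1)) :
    DifferentiableOn ℂ (fun p : (Fin m → ℂ) × (Fin m → ℂ) => ∫ s in (0 : ℝ)..1, f ((s : ℂ) • p.1, p.2))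
      (ball 0 1) := by
  let P : (Fin m → ℂ) × (Fin m → ℂ) →L[ℂ] (Fin m → ℂ) × (Fin m → ℂ) :=
    (ContinuousLinearMap.inl ℂ _ _).comp (ContinuousLinearMap.fst ℂ _ _)
  let R : (Fin m → ℂ) × (Fin m → ℂ) →L[ℂ] (Fin m → ℂ) × (Fin m → ℂ) :=
    (ContinuousLinearMap.inr ℂ _ _).comp (ContinuousLinearMap.snd ℂ _ _)
  have hval : ∀ (s : ℝ) p, ((s : ℂ) • P + R) p = ((s : ℂ) • p.1, p.2) := fun s p => by
    simp [P, R]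
  have := differentiableOn_integral_comp hf (φ := fun s => (s : ℂ) • P + R) (by fun_prop) (by
    intro s hs p
    rw [hval, Prod.norm_def, Prod.norm_def]
    refine max_le_max ?_ le_rfl
    rw [norm_smul, Complex.norm_real, Real.norm_of_nonneg hs.1]
    exact mul_le_of_le_one_left (norm_nonneg _) hs.2)
  simpa only [hval] using this

theorem differentiableOn_integral_right {f : (Fin m → ℂ) × (Fin m → ℂ) → ℂ}
    (hf : DifferentiableOn ℂ f (ball 0 1)) :
    DifferentiableOn ℂ (fun p : (Fin m → ℂ) × (Fin m → ℂ) => ∫ t in (0 : ℝ)..1, f (p.1, (t : ℂ) • p.2))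
      (ball 0 1) := by
  let P : (Fin m → ℂ) × (Fin m → ℂ) →L[ℂ] (Fin m → ℂ) × (Fin m → ℂ) :=
    (ContinuousLinearMap.inl ℂ _ _).comp (ContinuousLinearMap.fst ℂ _ _)
  let R : (Fin m → ℂ) × (Fin m → ℂ) →L[ℂ] (Fin m → ℂ) × (Fin m → ℂ) :=
    (ContinuousLinearMap.inr ℂ _ _).comp (ContinuousLinearMap.snd ℂ _ _)
  have hval : ∀ (s : ℝ) p, (P + (s : ℂ) • R) p = (p.1, (s : ℂ) • p.2) := fun s p => by
    simp [P, R]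
  have := differentiableOn_integral_comp hf (φ := fun s => P + (s : ℂ) • R) (by fun_prop) (by
    intro s hs p
    rw [hval, Prod.norm_def, Prod.norm_def]
    refine max_le_max le_rfl ?_
    rw [norm_smul, Complex.norm_real, Real.norm_of_nonneg hs.1]
    exact mul_le_of_le_one_left (norm_nonneg _) hs.2)
  simpa only [hval] using this

theorem differentiableOn_integral_integral {f : (Fin m → ℂ) × (Fin m → ℂ) → ℂ}
    (hf : DifferentiableOn ℂ f (ball 0 1)) :
    DifferentiableOn ℂ (fun p : (Fin m → ℂ) × (Fin m → ℂ) => ∫ t in (0 : ℝ)..1, ∫ s in (0 : ℝ)..1,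
      f ((s : ℂ) • p.1, (t : ℂ) • p.2)) (ball 0 1) :=
  differentiableOn_integral_right (differentiableOn_integral_left hf)

theorem smul_mem_ball_one {z v : Fin m → ℂ}
    (h : ((z, v) : (Fin m → ℂ) × (Fin m → ℂ)) ∈ ball 0 1) {s t : ℝ}
    (hs : s ∈ Icc (0 : ℝ) 1) (ht : t ∈ Icc (0 : ℝ) 1) :
    (((s : ℂ) • z, (t : ℂ) • v) : (Fin m → ℂ) × (Fin m → ℂ)) ∈ ball 0 1 := by
  rw [mk_mem_ball_iff] at h ⊢
  rw [norm_smul, norm_smul, Complex.norm_real, Complex.norm_real, Real.norm_of_nonneg hs.1,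
    Real.norm_of_nonneg ht.1]
  exact ⟨(mul_le_of_le_one_left (norm_nonneg _) hs.2).trans_lt h.1,
    (mul_le_of_le_one_left (norm_nonneg _) ht.2).trans_lt h.2⟩

theorem sum_integral_integral {ι : Type*} [Fintype ι] {f : ι → (Fin m → ℂ) × (Fin m → ℂ) → ℂ}
    (hf : ∀ k, DifferentiableOn ℂ (f k) (ball 0 1)) (c : ι → ℂ) {z v : ι → Fin m → ℂ}
    (h : ∀ k, (z k, v k) ∈ ball (0 : (Fin m → ℂ) × (Fin m → ℂ)) 1) :
    ∑ k, c k * ∫ t in (0 : ℝ)..1, ∫ s in (0 : ℝ)..1, f k ((s : ℂ) • z k, (t : ℂ) • v k) =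
      ∫ t in (0 : ℝ)..1, ∫ s in (0 : ℝ)..1,
        ∑ k, c k * f k ((s : ℂ) • z k, (t : ℂ) • v k) := by
  have h01 : (1 : ℝ) ∈ Icc (0 : ℝ) 1 := by simp
  have h1 : ∀ k, ContinuousOn (fun t : ℝ => ∫ s in (0 : ℝ)..1,
      f k ((s : ℂ) • z k, (t : ℂ) • v k)) (Icc 0 1) := fun k => by
    have hc : Continuous fun t : ℝ => (z k, (t : ℂ) • v k) := by fun_prop
    exact (differentiableOn_integral_left (hf k)).continuousOn.comp hc.continuousOn
      fun t ht => by simpa using smul_mem_ball_one (h k) h01 ht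
  have h2 : ∀ k, ∀ t ∈ Icc (0 : ℝ) 1, ContinuousOn (fun s : ℝ =>
      f k ((s : ℂ) • z k, (t : ℂ) • v k)) (Icc 0 1) := fun k t ht => by
    have hc : Continuous fun s : ℝ => ((s : ℂ) • z k, (t : ℂ) • v k) := by fun_prop
    exact (hf k).continuousOn.comp hc.continuousOn fun s hs => smul_mem_ball_one (h k) hs ht
  simp only [← intervalIntegral.integral_const_mul]
  rw [← intervalIntegral.integral_finsetSum]
  · refine intervalIntegral.integral_congr fun t ht => ?_
    rw [uIcc_of_le zero_le_one] at ht
    rw [intervalIntegral.integral_finsetSum]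
    intro k _
    refine ContinuousOn.intervalIntegrable ?_
    rw [uIcc_of_le zero_le_one]
    exact continuousOn_const.mul (h2 k t ht)
  · intro k _
    refine ContinuousOn.intervalIntegrable ?_
    rw [uIcc_of_le zero_le_one]
    simp only [intervalIntegral.integral_const_mul]
    exact continuousOn_const.mul (h1 k)

/-- The potential of a matrix kernel `F`, normalized at the origin. -/
def potential (F : (Fin m → ℂ) → (Fin m → ℂ) → Matrix (Fin m) (Fin m) ℂ)
    (p : (Fin m → ℂ) × (Fin m → ℂ)) : ℂ :=
  ∑ k : Fin m × Fin m, p.1 k.1 * p.2 k.2 * ∫ t in (0 : ℝ)..1, ∫ s in (0 : ℝ)..1,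
    F ((s : ℂ) • p.1) (star ((t : ℂ) • p.2)) k.1 k.2

variable {F : (Fin m → ℂ) → (Fin m → ℂ) → Matrix (Fin m) (Fin m) ℂ}

theorem differentiableOn_potential
    (hF : ∀ i j, IsSesquiholomorphicOn (polydisc m) fun z w => F z w i j) :
    DifferentiableOn ℂ (potential F) (ball 0 1) := by
  refine DifferentiableOn.fun_sum fun k _ => DifferentiableOn.mul ?_
    (differentiableOn_integral_integral (isSesquiholomorphicOn_polydisc.1 (hF k.1 k.2)))
  exact Differentiable.differentiableOn (by fun_prop)

theorem sum_potential {n : ℕ} (u : Fin n → Fin m → ℂ) (x : Fin n → ℂ) :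
    ∑ a, ∑ b, star (x a) * potential F (u a, star (u b)) * x b =
      ∑ k : (Fin n × Fin m) × (Fin n × Fin m),
        (star (star (u k.1.1 k.1.2) * x k.1.1) * (star (u k.2.1 k.2.2) * x k.2.1)) *
        ∫ t in (0 : ℝ)..1, ∫ s in (0 : ℝ)..1,
          F ((s : ℂ) • u k.1.1) (star ((t : ℂ) • star (u k.2.1))) k.1.2 k.2.2 := by
  simp only [Fintype.sum_prod_type, potential]
  refine Finset.sum_congr rfl fun a _ => ?_
  rw [Finset.sum_comm]
  refine Finset.sum_congr rfl fun b _ => ?_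
  rw [Finset.mul_sum, Finset.sum_mul]
  refine Finset.sum_congr rfl fun i _ => ?_
  rw [Finset.mul_sum, Finset.sum_mul]
  refine Finset.sum_congr rfl fun j _ => ?_
  rw [star_mul', star_star, Pi.star_apply]
  ring

/-- The factors z_i and v_j are absorbed into the coefficient vector, y(a, i) = conj(u_a,i) x_a.
What remains is a double integral over s, t of the form of F at the points s u_a and t u_b. Its sums
over sample parameters are again values of the form of F. -/
theorem isPosDefKernelOn_potential
    (hF : ∀ i j, IsSesquiholomorphicOn (polydisc m) fun z w => F z w i j)
    (hpos : IsPosDefMatrixKernelOn (polydisc m) F) :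
    IsPosDefKernelOn (polydisc m) fun z w => potential F (z, star w) := by
  intro n u hu
  rw [posSemidef_iff_sum_nonneg]
  intro x
  have hFd := fun i j => isSesquiholomorphicOn_polydisc.1 (hF i j)
  have hub : ∀ a b, ((u a, star (u b)) : (Fin m → ℂ) × (Fin m → ℂ)) ∈ ball 0 1 := fun a b =>
    mem_ball_one_iff.2 ⟨hu a, by simpa using hu b⟩
  refine le_of_le_of_eq ?_ (sum_potential u x).symm
  rw [sum_integral_integral (f := fun (k : (Fin n × Fin m) × (Fin n × Fin m)) p =>
    F p.1 (star p.2) k.1.2 k.2.2) (fun k => hFd _ _) _ (fun k => hub k.1.1 k.2.1)]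
  generalize hy : (fun p : Fin n × Fin m => star (u p.1 p.2) * x p.1) = y
  have hy' : ∀ p : Fin n × Fin m, star (u p.1 p.2) * x p.1 = y p := fun p => by rw [← hy]
  simp only [hy']
  refine integral_integral_nonneg (φ := fun s t => ∑ k : (Fin n × Fin m) × (Fin n × Fin m),
    (star (y k.1) * y k.2) *
      F ((s : ℂ) • u k.1.1) (star ((t : ℂ) • star (u k.2.1))) k.1.2 k.2.2) ?_ ?_
  · refine continuousOn_finsetSum _ fun k _ => continuousOn_const.mul ?_
    have hc : Continuous fun q : ℝ × ℝ => ((q.1 : ℂ) • u k.1.1, (q.2 : ℂ) • star (u k.2.1)) := by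
      fun_prop
    exact (hFd k.1.2 k.2.2).continuousOn.comp hc.continuousOn
      fun q hq => smul_mem_ball_one (hub _ _) hq.1 hq.2
  · intro N s hs
    have hmem : ∀ q : Fin N × Fin n, (s q.1 : ℂ) • u q.2 ∈ polydisc m := fun q => by
      have := smul_mem_ball_one (hub q.2 q.2) (hs q.1) (hs q.1)
      exact (mem_ball_one_iff.1 this).1
    -- The points are s_k u_a for all pairs (k, a), and the vector does not depend on the sample
    -- index k.
    have h2 := posSemidef_iff_sum_nonneg.1
      ((hpos.posSemidef (fun q : Fin N × Fin n => (s q.1 : ℂ) • u q.2) hmem).submatrix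
        (Equiv.prodAssoc (Fin N) (Fin n) (Fin m)).symm) (fun q => y q.2)
    have hstar : ∀ (l : Fin N) b, star ((s l : ℂ) • star (u b)) = (s l : ℂ) • u b := fun l b => by
      rw [star_smul, star_star, Complex.star_def, Complex.conj_ofReal]
    refine h2.trans_eq ?_
    rw [Fintype.sum_prod_type]
    refine Finset.sum_congr rfl fun k _ => ?_
    simp only [Fintype.sum_prod_type (α₁ := Fin N)]
    rw [Finset.sum_comm]
    refine Finset.sum_congr rfl fun l _ => ?_
    rw [Fintype.sum_prod_type (α₁ := Fin n × Fin m)]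
    refine Finset.sum_congr rfl fun p _ => Finset.sum_congr rfl fun q _ => ?_
    rw [hstar]
    simp only [Matrix.submatrix_apply, Matrix.of_apply, Equiv.prodAssoc_symm_apply]
    ring

/-- Q may a priori vanish off the diagonal, so the identity is stated in exponential form without
division. Near the origin a logarithm of Q exists and the potential is its second difference; the
identity theorem does the rest. -/
theorem potential_spec {Q : (Fin m → ℂ) × (Fin m → ℂ) → ℂ}
    (hQ : DifferentiableOn ℂ Q (ball 0 1)) (hQpos : ∀ w ∈ polydisc m, 0 < Q (w, star w))
    (hF : ∀ i j, IsSesquiholomorphicOn (polydisc m) fun z w => F z w i j)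
    (hFQ : ∀ w ∈ polydisc m, ∀ i j, F w w i j = mixedLog i j Q (w, star w))
    {z v : Fin m → ℂ} (hzv : ((z, v) : (Fin m → ℂ) × (Fin m → ℂ)) ∈ ball 0 1) :
    Complex.exp (potential F (z, v)) * (Q (z, 0) * Q (0, v)) = Q (z, v) * Q (0, 0) := by
  have hfst : ∀ p ∈ ball (0 : (Fin m → ℂ) × (Fin m → ℂ)) 1,
      ((p.1, 0) : (Fin m → ℂ) × (Fin m → ℂ)) ∈ ball 0 1 := fun p hp =>
    mk_mem_ball_iff.2 ⟨(mk_mem_ball_iff.1 hp).1, by simp⟩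
  have hsnd : ∀ p ∈ ball (0 : (Fin m → ℂ) × (Fin m → ℂ)) 1,
      ((0, p.2) : (Fin m → ℂ) × (Fin m → ℂ)) ∈ ball 0 1 := fun p hp =>
    mk_mem_ball_iff.2 ⟨by simp, (mk_mem_ball_iff.1 hp).2⟩
  have hQ1 : DifferentiableOn ℂ (fun p : (Fin m → ℂ) × (Fin m → ℂ) => Q (p.1, 0)) (ball 0 1) :=
    hQ.comp (Differentiable.differentiableOn (by fun_prop)) hfst
  have hQ2 : DifferentiableOn ℂ (fun p : (Fin m → ℂ) × (Fin m → ℂ) => Q (0, p.2)) (ball 0 1) :=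
    hQ.comp (Differentiable.differentiableOn (by fun_prop)) hsnd
  refine eqOn_ball_of_eventuallyEq
    (f := fun p => Complex.exp (potential F p) * (Q (p.1, 0) * Q (0, p.2)))
    (g := fun p => Q p * Q (0, 0)) ((differentiableOn_potential hF).cexp.mul (hQ1.mul hQ2))
    (hQ.mul_const _) ?_ hzv
  have h00 : (0 : Fin m → ℂ) ∈ polydisc m := by simp [polydisc]
  have hQ0 : 0 < Q 0 := by
    have := hQpos 0 h00
    rwa [star_zero] at this
  have hQc : ContinuousAt Q 0 :=
    (hQ.differentiableAt (isOpen_ball.mem_nhds (mem_ball_self one_pos))).continuousAt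
  obtain ⟨r, hr, hball⟩ : ∃ r > 0, ball (0 : (Fin m → ℂ) × (Fin m → ℂ)) r ⊆
      ball 0 1 ∩ Q ⁻¹' Complex.slitPlane :=
    Metric.mem_nhds_iff.1 (inter_mem (ball_mem_nhds _ one_pos)
      (hQc (Complex.isOpen_slitPlane.mem_nhds (Or.inl (Complex.lt_def.1 hQ0).1))))
  have hlog : DifferentiableOn ℂ (fun p => Complex.log (Q p)) (ball 0 r) := fun p hp =>
    ((hQ.differentiableAt (isOpen_ball.mem_nhds (hball hp).1)).clog
      (hball hp).2).differentiableWithinAt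
  have hne : ∀ p ∈ ball (0 : (Fin m → ℂ) × (Fin m → ℂ)) r, Q p ≠ 0 := fun p hp =>
    Complex.slitPlane_ne_zero (hball hp).2
  have hexp : ∀ p ∈ ball (0 : (Fin m → ℂ) × (Fin m → ℂ)) r, Complex.exp (Complex.log (Q p)) = Q p :=
    fun p hp => Complex.exp_log (hne p hp)
  have hmix : ∀ i j, ∀ p ∈ ball (0 : (Fin m → ℂ) × (Fin m → ℂ)) r,
      F p.1 (star p.2) i j = mixed i j (fun p => Complex.log (Q p)) p := by
    intro i j p hp
    -- F and the mixed derivatives of log Q agree on the diagonal, hence everywhere near the origin.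
    have := eqOn_zero_of_diagonal
      (f := fun p => F p.1 (star p.2) i j - mixed i j (fun p => Complex.log (Q p)) p)
      (((isSesquiholomorphicOn_polydisc.1 (hF i j)).mono fun p hp => (hball hp).1).sub
        (differentiableOn_mixed isOpen_ball hlog i j)) (fun w hw => ?_) hp
    · exact sub_eq_zero.1 this
    · have hwr : ((w, star w) : (Fin m → ℂ) × (Fin m → ℂ)) ∈ ball 0 r :=
        mk_mem_ball_iff.2 ⟨hw, by rwa [norm_star]⟩
      have hw1 : w ∈ polydisc m := (mem_ball_one_iff.1 (hball hwr).1).1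
      simp only [star_star]
      rw [hFQ w hw1, mixedLog_eq_mixed isOpen_ball hlog hexp hwr, sub_self]
  filter_upwards [ball_mem_nhds _ hr] with p hp
  obtain ⟨z, v⟩ := p
  have hst : ∀ s ∈ Icc (0 : ℝ) 1, ∀ t ∈ Icc (0 : ℝ) 1,
      (((0 : Fin m → ℂ) + (s : ℂ) • z, (0 : Fin m → ℂ) + (t : ℂ) • v) :
        (Fin m → ℂ) × (Fin m → ℂ)) ∈ ball 0 r := by
    intro s hs t ht
    rw [mk_mem_ball_iff] at hp ⊢
    rw [zero_add, zero_add, norm_smul, norm_smul, Complex.norm_real, Complex.norm_real,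
      Real.norm_of_nonneg hs.1, Real.norm_of_nonneg ht.1]
    exact ⟨(mul_le_of_le_one_left (norm_nonneg _) hs.2).trans_lt hp.1,
      (mul_le_of_le_one_left (norm_nonneg _) ht.2).trans_lt hp.2⟩
  have hsd := second_difference_eq_integral isOpen_ball hlog hst
  have hpot : potential F (z, v) = ∫ t in (0 : ℝ)..1, ∫ s in (0 : ℝ)..1,
      ∑ i, ∑ j, z i * v j * mixed i j (fun p => Complex.log (Q p))
        (0 + (s : ℂ) • z, 0 + (t : ℂ) • v) := by
    refine (sum_integral_integral (f := fun (k : Fin m × Fin m) p => F p.1 (star p.2) k.1 k.2)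
      (fun k => isSesquiholomorphicOn_polydisc.1 (hF k.1 k.2)) _ (fun _ => (hball hp).1)).trans ?_
    refine intervalIntegral.integral_congr fun t ht => ?_
    refine intervalIntegral.integral_congr fun s hs => ?_
    rw [uIcc_of_le zero_le_one] at hs ht
    simp only
    rw [Fintype.sum_prod_type]
    refine Finset.sum_congr rfl fun i _ => Finset.sum_congr rfl fun j _ => ?_
    rw [← hmix i j _ (hst s hs t ht)]
    simp
  have hz : ((z, 0) : (Fin m → ℂ) × (Fin m → ℂ)) ∈ ball 0 r :=
    mk_mem_ball_iff.2 ⟨(mk_mem_ball_iff.1 hp).1, by simpa using hr⟩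
  have hv : ((0, v) : (Fin m → ℂ) × (Fin m → ℂ)) ∈ ball 0 r :=
    mk_mem_ball_iff.2 ⟨by simpa using hr, (mk_mem_ball_iff.1 hp).2⟩
  have h0 : ((0, 0) : (Fin m → ℂ) × (Fin m → ℂ)) ∈ ball 0 r := mem_ball_self hr
  simp only [zero_add] at hsd hpot
  simp only
  rw [hpot, ← hsd, Complex.exp_add, Complex.exp_sub, Complex.exp_sub, hexp _ hp, hexp _ hz,
    hexp _ hv, hexp _ h0]
  have := hne _ hz
  have := hne _ hv
  field_simp

/-- The logarithm is L = P + ℓ(z) + conj ℓ(w) - c. The one-variable terms only contribute the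
rank-one factor e^{tℓ(z)} conj e^{tℓ(w)}, so positivity of exp(tL) reduces to that of exp(tP). -/
theorem isInfinitelyDivisibleOn_of_mixedLog {Q : (Fin m → ℂ) × (Fin m → ℂ) → ℂ}
    (hQ : DifferentiableOn ℂ Q (ball 0 1)) (hQpos : ∀ w ∈ polydisc m, 0 < Q (w, star w))
    (hQstar : ∀ v ∈ polydisc m, Q (0, star v) = star (Q (v, 0)))
    (hF : ∀ i j, IsSesquiholomorphicOn (polydisc m) fun z w => F z w i j)
    (hFQ : ∀ w ∈ polydisc m, ∀ i j, F w w i j = mixedLog i j Q (w, star w))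
    (hpos : IsPosDefMatrixKernelOn (polydisc m) F) :
    IsInfinitelyDivisibleOn (polydisc m) fun z w => Q (z, star w) := by
  have h00 : (0 : Fin m → ℂ) ∈ polydisc m := by simp [polydisc]
  have hQ0 : 0 < Q (0, 0) := by
    have := hQpos 0 h00
    rwa [star_zero] at this
  have hmem : ∀ z ∈ polydisc m, ∀ w ∈ polydisc m,
      ((z, star w) : (Fin m → ℂ) × (Fin m → ℂ)) ∈ ball 0 1 := fun z hz w hw =>
    mem_ball_one_iff.2 ⟨hz, by simpa using hw⟩
  -- At v = z̄ the right side of `potential_spec` is a product of positive numbers, so Q(z, 0)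
  -- cannot vanish.
  have hne : ∀ z ∈ ball (0 : Fin m → ℂ) 1, Q (z, 0) ≠ 0 := by
    intro z hz h0
    rw [← polydisc_eq_ball] at hz
    have := potential_spec hQ hQpos hF hFQ (hmem z hz z hz)
    rw [h0, zero_mul, mul_zero] at this
    exact mul_ne_zero (hQpos z hz).ne' hQ0.ne' this.symm
  obtain ⟨ℓ, hℓd, hℓ⟩ := exists_log_of_ne_zero one_pos (f := fun z : Fin m → ℂ => Q (z, 0))
    (hQ.comp (Differentiable.differentiableOn (by fun_prop)) fun z hz =>
      mk_mem_ball_iff.2 ⟨by simpa using hz, by simp⟩) hne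
  rw [← polydisc_eq_ball] at hℓ
  set c : ℝ := Real.log (Q (0, 0)).re with hc
  have hcexp : Complex.exp c = Q (0, 0) := by
    obtain ⟨h1, h2⟩ := Complex.lt_def.1 hQ0
    rw [hc, ← Complex.ofReal_exp, Real.exp_log h1]
    exact Complex.ext rfl (by simpa using h2)
  have hP := isPosDefKernelOn_potential hF hpos
  refine ⟨fun z w => potential F (z, star w) + ℓ z + star (ℓ w) - c, ?_, ?_, ?_, ?_⟩
  · rw [isSesquiholomorphicOn_polydisc]
    simp only [star_star]
    refine (((differentiableOn_potential hF).add ?_).add ?_).sub_const _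
    · exact hℓd.comp differentiableOn_fst fun p hp => by
        simpa using (mk_mem_ball_iff.1 hp).1
    · intro p hp
      have h1 : star p.2 ∈ ball (0 : Fin m → ℂ) 1 := by
        simpa using (mk_mem_ball_iff.1 hp).2
      have h2 := (hℓd.differentiableAt (isOpen_ball.mem_nhds h1)).star_star
      rw [star_star] at h2
      exact (DifferentiableAt.comp (g := star ∘ ℓ ∘ star) p h2
        differentiableAt_snd).differentiableWithinAt
  · intro z hz w hw
    have h1 := potential_spec hQ hQpos hF hFQ (hmem z hz w hw)
    rw [Complex.exp_sub, Complex.exp_add, Complex.exp_add, hcexp, hℓ z hz]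
    have h2 : Complex.exp (star (ℓ w)) = Q (0, star w) := by
      rw [hQstar w hw, ← hℓ w hw]
      exact Complex.exp_conj _
    rw [h2, div_eq_iff hQ0.ne', ← h1]
    ring
  · intro w hw
    have h1 := (hP.posSemidef (ι := Unit) (fun _ => w) fun _ => hw).diag_nonneg (i := ())
    simp only [Matrix.of_apply] at h1
    have h2 := (Complex.le_def.1 h1).2
    simp only [Complex.zero_im] at h2
    simp [← h2]
  · intro t ht
    have h1 := (((isPosDefKernelOn_const (Ω := polydisc m) ht.le).mul hP).exp.mul
      (isPosDefKernelOn_mul_star fun z => Complex.exp (t * ℓ z))).mul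
      (isPosDefKernelOn_const (Ω := polydisc m) (Real.exp_pos (-(t * c))).le)
    refine h1.congr fun z _ w _ => ?_
    have h2 : star (Complex.exp (t * ℓ w)) = Complex.exp (t * star (ℓ w)) := by
      rw [Complex.star_def, ← Complex.exp_conj, map_mul, Complex.conj_ofReal]
    rw [h2, Complex.ofReal_exp, ← Complex.exp_add, ← Complex.exp_add, ← Complex.exp_add]
    congr 1
    push_cast
    ring

end ToInfinitelyDivisible

/-! ### Weakly holomorphic maps into a Hilbert space. -/

section WeakHolomorphy

theorem norm_le_of_forall_inner_le {H : Type*} [NormedAddCommGroup H] [InnerProductSpace ℂ H]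
    {D : Submodule ℂ H} (hD : D.topologicalClosure = ⊤) {v : H} {c : ℝ} (hc : 0 ≤ c)
    (h : ∀ f ∈ D, ‖inner ℂ f v‖ ≤ c * ‖f‖) : ‖v‖ ≤ c := by
  have hcl : IsClosed {f : H | ‖inner ℂ f v‖ ≤ c * ‖f‖} :=
    isClosed_le (by fun_prop) (by fun_prop)
  have hv : v ∈ closure (D : Set H) := by
    rw [← Submodule.topologicalClosure_coe, hD]
    trivial
  have h1 : ‖inner ℂ v v‖ ≤ c * ‖v‖ := hcl.closure_subset_iff.2 h hv
  rw [inner_self_eq_norm_sq_to_K, norm_pow, RCLike.norm_ofReal, abs_norm, pow_two] at h1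
  rcases eq_or_lt_of_le (norm_nonneg v) with h0 | h0
  · rw [← h0]; exact hc
  · exact le_of_mul_le_mul_right h1 h0

/-- The quadratic remainder estimate for bounded holomorphic functions on a ball. -/
theorem norm_sub_sub_fderiv_le {E : Type*} [NormedAddCommGroup E] [NormedSpace ℂ E] {f : E → ℂ}
    {x₀ x : E} {r B : ℝ} (hf : DifferentiableOn ℂ f (ball x₀ r))
    (hB : ∀ y ∈ ball x₀ r, ‖f y‖ ≤ B) (hx : x ∈ ball x₀ r) :
    ‖f x - f x₀ - fderiv ℂ f x₀ (x - x₀)‖ ≤ 4 * B / r ^ 2 * ‖x - x₀‖ ^ 2 := by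
  rcases eq_or_ne x x₀ with rfl | hne
  · simp
  have hd : 0 < ‖x - x₀‖ := norm_pos_iff.2 (sub_ne_zero.2 hne)
  have hr : 0 < r := (dist_nonneg).trans_lt hx
  have hxr : ‖x - x₀‖ < r := by rwa [mem_ball, dist_eq_norm] at hx
  -- The line τ ↦ x₀ + τ(x - x₀) stays in the ball for |τ| < ρ and reaches x at τ = 1. The Schwarz
  -- lemma, applied to g and then to its difference quotient, gains a factor 1/ρ each time.
  set ρ := r / ‖x - x₀‖ with hρ
  have hρ1 : 1 < ρ := by rwa [hρ, one_lt_div hd]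
  have hρ0 : 0 < ρ := one_pos.trans hρ1
  have hmaps : ∀ τ ∈ ball (0 : ℂ) ρ, x₀ + τ • (x - x₀) ∈ ball x₀ r := by
    intro τ hτ
    rw [mem_ball_zero_iff, hρ, lt_div_iff₀ hd] at hτ
    rw [mem_ball, dist_eq_norm, add_sub_cancel_left, norm_smul]
    exact hτ
  set g : ℂ → ℂ := fun τ => f (x₀ + τ • (x - x₀)) with hg
  have hgd : DifferentiableOn ℂ g (ball 0 ρ) :=
    hf.comp (Differentiable.differentiableOn (by fun_prop)) hmaps
  have h0 : (0 : ℂ) ∈ ball (0 : ℂ) ρ := mem_ball_self hρ0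
  have h1 : (1 : ℂ) ∈ ball (0 : ℂ) ρ := by simpa using hρ1
  have hgm : MapsTo g (ball 0 ρ) (closedBall (g 0) (2 * B)) := by
    intro τ hτ
    rw [mem_closedBall, dist_eq_norm]
    have := norm_sub_le (g τ) (g 0)
    have h2 := hB _ (hmaps τ hτ)
    have h3 := hB _ (hmaps 0 h0)
    simp only [hg] at this ⊢
    linarith
  have hsd : DifferentiableOn ℂ (dslope g 0) (ball 0 ρ) :=
    (Complex.differentiableOn_dslope (isOpen_ball.mem_nhds h0)).2 hgd
  have hsm : MapsTo (dslope g 0) (ball 0 ρ) (closedBall (dslope g 0 0) (4 * B / ρ)) := by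
    intro τ hτ
    rw [mem_closedBall, dist_eq_norm]
    have h2 := Complex.norm_dslope_le_div_of_mapsTo_ball hgd hgm hτ
    have h3 := Complex.norm_dslope_le_div_of_mapsTo_ball hgd hgm h0
    calc _ ≤ ‖dslope g 0 τ‖ + ‖dslope g 0 0‖ := norm_sub_le _ _
      _ ≤ 2 * B / ρ + 2 * B / ρ := add_le_add h2 h3
      _ = 4 * B / ρ := by ring
  have hfin := Complex.dist_le_div_mul_dist_of_mapsTo_ball hsd hsm h1
  have hderiv : dslope g 0 0 = fderiv ℂ f x₀ (x - x₀) := by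
    rw [dslope_same]
    have e1 : HasFDerivAt f (fderiv ℂ f x₀) (x₀ + (0 : ℂ) • (x - x₀)) := by
      simpa using (hf.differentiableAt (ball_mem_nhds x₀ hr)).hasFDerivAt
    have e2 : HasDerivAt (fun τ : ℂ => x₀ + τ • (x - x₀)) (x - x₀) 0 := by
      simpa using ((hasDerivAt_id (0 : ℂ)).smul_const (x - x₀)).const_add x₀
    exact (e1.comp_hasDerivAt (0 : ℂ) e2).deriv
  have hone : dslope g 0 1 = f x - f x₀ := by
    rw [dslope_of_ne _ one_ne_zero, slope_def_field]
    simp [hg]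
  rw [hderiv, hone, dist_eq_norm] at hfin
  refine hfin.trans (le_of_eq ?_)
  rw [hρ]
  simp
  field_simp

variable {m : ℕ}

/-- A locally bounded map into a Hilbert space is holomorphic if its inner products with the
vectors of a dense subspace are. -/
theorem differentiableAt_of_inner {H : Type*} [NormedAddCommGroup H] [InnerProductSpace ℂ H]
    [CompleteSpace H] {Γ : (Fin m → ℂ) → H} {D : Submodule ℂ H} (hD : D.topologicalClosure = ⊤)
    {x₀ : Fin m → ℂ} {r C : ℝ} (hr : 0 < r) (hC : ∀ x ∈ ball x₀ r, ‖Γ x‖ ≤ C)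
    (hΓ : ∀ f ∈ D, DifferentiableOn ℂ (fun x => inner ℂ f (Γ x)) (ball x₀ r)) :
    DifferentiableAt ℂ Γ x₀ := by
  have hC0 : 0 ≤ C := (norm_nonneg _).trans (hC x₀ (mem_ball_self hr))
  have hB : ∀ f : H, ∀ x ∈ ball x₀ r, ‖inner ℂ f (Γ x)‖ ≤ C * ‖f‖ := fun f x hx => by
    have := (norm_inner_le_norm (𝕜 := ℂ) f (Γ x)).trans
      (mul_le_mul_of_nonneg_left (hC x hx) (norm_nonneg f))
    rwa [mul_comm] at this
  have hfd : ∀ f ∈ D, DifferentiableAt ℂ (fun x => inner ℂ f (Γ x)) x₀ := fun f hf =>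
    (hΓ f hf).differentiableAt (ball_mem_nhds x₀ hr)
  have hexists : ∀ e : Fin m → ℂ, ∃ a : H, ∀ f ∈ D,
      inner ℂ f a = fderiv ℂ (fun x => inner ℂ f (Γ x)) x₀ e := by
    intro e
    -- The candidate for the derivative in direction e comes from Riesz representation. The
    -- functional is conjugated because the inner product is antilinear in f; the Cauchy estimate
    -- bounds it, and Hahn–Banach extends it from D.
    let μ : D →ₗ[ℂ] ℂ :=
      { toFun := fun f => star (fderiv ℂ (fun x => inner ℂ (f : H) (Γ x)) x₀ e)
        map_add' := fun f g => by
          have : (fun x => inner ℂ ((f + g : D) : H) (Γ x)) =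
              (fun x => inner ℂ (f : H) (Γ x)) + fun x => inner ℂ (g : H) (Γ x) := by
            funext x; simp
          rw [this, fderiv_add (hfd f f.2) (hfd g g.2)]
          simp
        map_smul' := fun c f => by
          have : (fun x => inner ℂ ((c • f : D) : H) (Γ x)) =
              fun x => star c * inner ℂ (f : H) (Γ x) := by
            funext x; simp [mul_comm]
          rw [this, fderiv_const_mul (hfd f f.2)]
          simp }
    have hμ : ∀ f : D, ‖μ f‖ ≤ (2 * C / r * ‖e‖) * ‖f‖ := by
      intro f
      have h1 := Complex.norm_fderiv_le_div_of_mapsTo_ball (hΓ f f.2)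
        (R₂ := 2 * (C * ‖(f : H)‖)) (fun x hx => by
          rw [mem_closedBall, dist_eq_norm]
          have h2 := norm_sub_le (inner ℂ (f : H) (Γ x)) (inner ℂ (f : H) (Γ x₀))
          have h3 := hB f x hx
          have h4 := hB f x₀ (mem_ball_self hr)
          linarith) hr
      calc ‖μ f‖ = ‖fderiv ℂ (fun x => inner ℂ (f : H) (Γ x)) x₀ e‖ := norm_star _
        _ ≤ ‖fderiv ℂ (fun x => inner ℂ (f : H) (Γ x)) x₀‖ * ‖e‖ :=
          ContinuousLinearMap.le_opNorm _ _
        _ ≤ (2 * (C * ‖(f : H)‖) / r) * ‖e‖ := mul_le_mul_of_nonneg_right h1 (norm_nonneg _)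
        _ = (2 * C / r * ‖e‖) * ‖f‖ := by rw [Submodule.coe_norm]; ring
    obtain ⟨g, hg, -⟩ := exists_extension_norm_eq D (μ.mkContinuous _ hμ)
    refine ⟨(InnerProductSpace.toDual ℂ H).symm g, fun f hf => ?_⟩
    rw [← inner_conj_symm, InnerProductSpace.toDual_symm_apply, hg ⟨f, hf⟩]
    simp [μ]
  choose a ha using hexists
  let A : (Fin m → ℂ) →L[ℂ] H :=
    ∑ i, (ContinuousLinearMap.proj (R := ℂ) (φ := fun _ : Fin m => ℂ) i).smulRight
      (a (Pi.single i 1))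
  have hA : ∀ f ∈ D, ∀ h, inner ℂ f (A h) = fderiv ℂ (fun x => inner ℂ f (Γ x)) x₀ h := by
    intro f hf h
    simp only [A, sum_apply, ContinuousLinearMap.smulRight_apply, ContinuousLinearMap.proj_apply,
      inner_sum, inner_smul_right, ha _ f hf]
    conv_rhs => rw [pi_eq_sum_univ' h, map_sum]
    simp
  have hO : (fun x => Γ x - Γ x₀ - A (x - x₀)) =O[𝓝 x₀] fun x => ‖x - x₀‖ ^ 2 := by
    refine Asymptotics.IsBigO.of_bound (4 * C / r ^ 2) ?_
    filter_upwards [ball_mem_nhds x₀ hr] with x hx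
    rw [Real.norm_of_nonneg (by positivity)]
    refine norm_le_of_forall_inner_le hD (by positivity) fun f hf => ?_
    rw [inner_sub_right, inner_sub_right, hA f hf]
    refine (norm_sub_sub_fderiv_le (hΓ f hf) (hB f) hx).trans (le_of_eq ?_)
    ring
  have h1 := (Asymptotics.IsBigO.hasFDerivAt (𝕜 := ℂ) hO one_lt_two).differentiableAt
  have h2 : Γ = fun x => (Γ x - Γ x₀ - A (x - x₀)) + (Γ x₀ + A (x - x₀)) := by
    funext x; abel
  rw [h2]
  exact h1.add (by fun_prop)

/-- Continuity of the squared norm supplies local boundedness. For both tuples this squared norm is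
an explicit kernel on the diagonal. -/
theorem differentiableOn_of_inner {H : Type*} [NormedAddCommGroup H] [InnerProductSpace ℂ H]
    [CompleteSpace H] {Γ : (Fin m → ℂ) → H} {D : Submodule ℂ H} (hD : D.topologicalClosure = ⊤)
    {U : Set (Fin m → ℂ)} (hU : IsOpen U) (hc : ContinuousOn (fun x => ‖Γ x‖ ^ 2) U)
    (hΓ : ∀ f ∈ D, DifferentiableOn ℂ (fun x => inner ℂ f (Γ x)) U) :
    DifferentiableOn ℂ Γ U := by
  intro x₀ hx₀
  have h1 : ∀ᶠ x in 𝓝 x₀, ‖Γ x‖ ^ 2 < ‖Γ x₀‖ ^ 2 + 1 :=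
    (hc.continuousAt (hU.mem_nhds hx₀)).eventually_lt continuousAt_const (by simp)
  obtain ⟨r, hr, hball⟩ := Metric.mem_nhds_iff.1 (inter_mem (hU.mem_nhds hx₀) h1)
  refine (differentiableAt_of_inner hD hr (C := ‖Γ x₀‖ ^ 2 + 2) (fun x hx => ?_)
    fun f hf => (hΓ f hf).mono fun x hx => (hball hx).1).differentiableWithinAt
  have h2 : ‖Γ x‖ ^ 2 < ‖Γ x₀‖ ^ 2 + 1 := (hball hx).2
  nlinarith [norm_nonneg (Γ x), sq_nonneg (‖Γ x‖ - 1)]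

end WeakHolomorphy

/-! ### The curvature from an arbitrary spanning section. -/

section Curvature

variable {m : ℕ} {H : Type*} [NormedAddCommGroup H] [InnerProductSpace ℂ H]

theorem mem_jointKernel {T : Fin m → H →L[ℂ] H} {w : Fin m → ℂ} {x : H} :
    x ∈ jointKernel T w ↔ ∀ i, T i x = w i • x := by
  simp [jointKernel, tupleMap, funext_iff, sub_eq_zero]

/-- The curvature matrix, computed from a holomorphic section that spans the joint kernels. -/
theorem curvatureMatrix_apply {T : Fin m → H →L[ℂ] H} {w : Fin m → ℂ} {Γ : (Fin m → ℂ) → H}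
    (hΓ : IsLocalSection T w Γ)
    (hspan : ∀ᶠ z in 𝓝 w, ∀ x ∈ jointKernel T z, ∃ c : ℂ, x = c • Γ z)
    {P : (Fin m → ℂ) × (Fin m → ℂ) → ℂ} {U : Set ((Fin m → ℂ) × (Fin m → ℂ))} (hU : IsOpen U)
    (hP : DifferentiableOn ℂ P U) (hw : (w, star w) ∈ U)
    (hPΓ : ∀ᶠ z in 𝓝 w, P (z, star z) = ((‖Γ z‖ ^ 2 : ℝ) : ℂ)) (i j : Fin m) :
    curvatureMatrix T w i j = -mixedLog i j P (w, star w) := by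
  have hex : ∃ γ, IsLocalSection T w γ := ⟨Γ, hΓ⟩
  rw [curvatureMatrix, dif_pos hex, Matrix.neg_apply, neg_inj]
  obtain ⟨V₁, hV₁, hwV₁, hγd, hγ⟩ := hex.choose_spec
  generalize hex.choose = γ at hγd hγ
  obtain ⟨V₂, hV₂, hwV₂, hΓd, hΓ0⟩ := hΓ
  have hΓc : ContinuousAt Γ w := (hΓd.differentiableAt (hV₂.mem_nhds hwV₂)).continuousAt
  have hne : ∀ᶠ z in 𝓝 w, inner ℂ (Γ w) (Γ z) ≠ 0 := by
    have : ContinuousAt (fun z => inner ℂ (Γ w) (Γ z)) w := continuousAt_const.inner hΓc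
    refine this.eventually_ne ?_
    exact inner_self_ne_zero.2 (hΓ0 w hwV₂).1
  obtain ⟨V, hVsub, hVo, hwV⟩ := _root_.mem_nhds_iff.1 (inter_mem (inter_mem (hV₁.mem_nhds hwV₁)
    (hV₂.mem_nhds hwV₂)) (inter_mem hne (inter_mem hspan hPΓ)))
  -- The chosen section γ is a pointwise multiple of Γ. Pairing with the fixed vector Γ(w) exhibits
  -- the multiplier as a quotient of holomorphic functions.
  set c : (Fin m → ℂ) → ℂ := fun z => inner ℂ (Γ w) (γ z) / inner ℂ (Γ w) (Γ z) with hc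
  have hcd : DifferentiableOn ℂ c V := by
    have hin : ∀ {φ : (Fin m → ℂ) → H}, DifferentiableOn ℂ φ V →
        DifferentiableOn ℂ (fun z => inner ℂ (Γ w) (φ z)) V := fun hφ =>
      (innerSL ℂ (Γ w)).differentiable.comp_differentiableOn hφ
    exact differentiableOn_div (hin (hγd.mono fun z hz => (hVsub hz).1.1))
      (hin (hΓd.mono fun z hz => (hVsub hz).1.2)) fun z hz => (hVsub hz).2.1
  have hcγ : ∀ z ∈ V, γ z = c z • Γ z := by
    intro z hz
    obtain ⟨d, hd⟩ := (hVsub hz).2.2.1 (γ z) (hγ z (hVsub hz).1.1).2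
    have : c z = d := by
      simp only [hc]
      rw [hd, inner_smul_right, mul_div_cancel_right₀ _ (hVsub hz).2.1]
    rw [this, hd]
  have hc0 : ∀ z ∈ V, c z ≠ 0 := by
    intro z hz h0
    apply (hγ z (hVsub hz).1.1).1
    rw [hcγ z hz, h0, zero_smul]
  have hPpos : ∀ z ∈ V, 0 < P (z, star z) := by
    intro z hz
    have h1 : P (z, star z) = ((‖Γ z‖ ^ 2 : ℝ) : ℂ) := (hVsub hz).2.2.2
    rw [h1, Complex.zero_lt_real]
    exact pow_pos (norm_pos_iff.2 (hΓ0 z (hVsub hz).1.2).1) 2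
  set W : Set ((Fin m → ℂ) × (Fin m → ℂ)) :=
    (U ∩ P ⁻¹' {0}ᶜ) ∩ {p | p.1 ∈ V ∧ star p.2 ∈ V} with hW
  have hWo : IsOpen W := by
    refine (hP.continuousOn.isOpen_inter_preimage hU isOpen_compl_singleton).inter ?_
    exact (hVo.preimage continuous_fst).inter (hVo.preimage (continuous_star.comp continuous_snd))
  have hwW : (w, star w) ∈ W := ⟨⟨hw, (hPpos w hwV).ne'⟩, hwV, by simpa using hwV⟩
  have hc1 : DifferentiableOn ℂ (fun p : (Fin m → ℂ) × (Fin m → ℂ) => c p.1) W :=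
    hcd.comp differentiableOn_fst fun p hp => hp.2.1
  have hc2 : DifferentiableOn ℂ (fun p : (Fin m → ℂ) × (Fin m → ℂ) => star (c (star p.2))) W := by
    intro p hp
    have h2 := (hcd.differentiableAt (hVo.mem_nhds hp.2.2)).star_star
    rw [star_star] at h2
    exact (DifferentiableAt.comp (g := star ∘ c ∘ star) p h2
      differentiableAt_snd).differentiableWithinAt
  have hP' : DifferentiableOn ℂ P W := hP.mono fun p hp => hp.1.1
  have hc10 : ∀ p ∈ W, c p.1 ≠ 0 := fun p hp => hc0 _ hp.2.1
  have hc20 : ∀ p ∈ W, star (c (star p.2)) ≠ 0 := fun p hp => star_ne_zero.2 (hc0 _ hp.2.2)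
  have hP0 : ∀ p ∈ W, P p ≠ 0 := fun p hp => hp.1.2
  -- This product polarizes ‖γ‖² = |c|² ‖Γ‖²; the two factors from c each depend on one variable
  -- only and drop out.
  rw [complexHessian_eq_mixedLog (Q := fun p => (c p.1 * star (c (star p.2))) * P p) hWo
    ((hc1.mul hc2).mul hP') hwW,
    mixedLog_mul (Q := fun p => c p.1 * star (c (star p.2))) hWo (hc1.mul hc2) hP'
      (fun p hp => mul_ne_zero (hc10 p hp) (hc20 p hp)) hP0 hwW,
    mixedLog_mul (Q := fun p => c p.1) (R := fun p => star (c (star p.2))) hWo hc1 hc2 hc10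
      hc20 hwW, mixedLog_comp_fst, mixedLog_comp_snd fun v => star (c (star v))]
  · simp
  · filter_upwards [hVo.mem_nhds hwV] with z hz
    have h1 : P (z, star z) = ((‖Γ z‖ ^ 2 : ℝ) : ℂ) := (hVsub hz).2.2.2
    have h2 : c z * star (c (star (star z))) * P (z, star z) = ((‖γ z‖ ^ 2 : ℝ) : ℂ) := by
      rw [h1, star_star, Complex.star_def, Complex.mul_conj, Complex.normSq_eq_norm_sq,
        ← Complex.ofReal_mul, hcγ z hz, norm_smul, mul_pow]
    rw [h2]
    refine ⟨?_, by rw [Complex.ofReal_re]⟩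
    rw [Complex.zero_lt_real]
    exact pow_pos (norm_pos_iff.2 (hγ z (hVsub hz).1.1).1) 2

end Curvature

/-! ### The adjoint shift on the Hardy space and its curvature. -/

section Hardy

theorem hasSum_prod_pow (m : ℕ) (x : Fin m → ℝ) (h0 : ∀ i, 0 ≤ x i) (h1 : ∀ i, x i < 1) :
    HasSum (fun I : Fin m → ℕ => ∏ i, x i ^ I i) (∏ i, (1 - x i)⁻¹) := by
  induction m with
  | zero => simp
  | succ m ih =>
    have e1 := hasSum_geometric_of_lt_one (h0 0) (h1 0)
    have e2 := ih (fun i => x i.succ) (fun i => h0 _) fun i => h1 _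
    have e3 := e1.mul e2 (Summable.mul_of_nonneg (f := fun k => x 0 ^ k)
      (g := fun I : Fin m → ℕ => ∏ i, x i.succ ^ I i) e1.summable e2.summable
      (fun k => pow_nonneg (h0 0) k) fun I => Finset.prod_nonneg fun i _ => pow_nonneg (h0 _) _)
    have e4 : (fun I : Fin (m + 1) → ℕ => ∏ i, x i ^ I i) ∘ Fin.consEquiv (fun _ => ℕ) =
        fun p : ℕ × (Fin m → ℕ) => x 0 ^ p.1 * ∏ i, x i.succ ^ p.2 i := by
      funext p
      simp [Fin.consEquiv, Fin.prod_univ_succ]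
    rw [Fin.prod_univ_succ, ← Equiv.hasSum_iff (Fin.consEquiv fun _ => ℕ), e4]
    exact e3

variable {m : ℕ}

theorem summable_monomial_values {z : Fin m → ℂ} (hz : z ∈ polydisc m) :
    HasSum (fun I : Fin m → ℕ => ‖∏ i, z i ^ I i‖ ^ 2) (∏ i, (1 - ‖z i‖ ^ 2)⁻¹) := by
  have := hasSum_prod_pow m (fun i => ‖z i‖ ^ 2) (fun i => by positivity) fun i =>
    pow_lt_one₀ (norm_nonneg _) (hz i) two_ne_zero
  convert this using 2 with I
  rw [norm_prod, ← Finset.prod_pow]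
  refine Finset.prod_congr rfl fun i _ => ?_
  rw [norm_pow, ← pow_mul, ← pow_mul, mul_comm]

open Classical in
/-- The joint eigenvector `∑ I, z^I e_I` of the adjoint of the shift. -/
def hardyEigenvector (z : Fin m → ℂ) : HardySpace m :=
  if hz : z ∈ polydisc m then
    ⟨fun I => ∏ i, z i ^ I i, memℓp_gen (by simpa using (summable_monomial_values hz).summable)⟩
  else 0

theorem hardyEigenvector_apply {z : Fin m → ℂ} (hz : z ∈ polydisc m) (I : Fin m → ℕ) :
    hardyEigenvector z I = ∏ i, z i ^ I i := by
  rw [hardyEigenvector, dif_pos hz]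

theorem norm_hardyEigenvector_sq {z : Fin m → ℂ} (hz : z ∈ polydisc m) :
    ‖hardyEigenvector z‖ ^ 2 = ∏ i, (1 - ‖z i‖ ^ 2)⁻¹ := by
  have h1 := lp.norm_rpow_eq_tsum (p := 2) (by simp) (hardyEigenvector z)
  simp only [ENNReal.toReal_ofNat, Real.rpow_ofNat] at h1
  rw [h1, ← (summable_monomial_values hz).tsum_eq]
  exact tsum_congr fun I => by rw [hardyEigenvector_apply hz]

theorem inner_monomial (I : Fin m → ℕ) (x : HardySpace m) : inner ℂ (monomial I) x = x I := by
  rw [monomial, lp.inner_single_left]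
  simp

theorem adjoint_hardyShift_apply (i : Fin m) (x : HardySpace m) (I : Fin m → ℕ) :
    ContinuousLinearMap.adjoint (hardyShift i) x I = x (I + Pi.single i 1) := by
  rw [← inner_monomial, ContinuousLinearMap.adjoint_inner_right, hardyShift_monomial,
    inner_monomial]

theorem mem_jointKernel_hardyShift {z : Fin m → ℂ} {x : HardySpace m} :
    x ∈ jointKernel (fun i : Fin m => ContinuousLinearMap.adjoint (hardyShift i)) z ↔
      ∀ i I, x (I + Pi.single i 1) = z i * x I := by
  rw [mem_jointKernel]
  refine forall_congr' fun i => ?_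
  rw [lp.ext_iff, funext_iff]
  refine forall_congr' fun I => ?_
  rw [adjoint_hardyShift_apply]
  simp

theorem hardyEigenvector_mem {z : Fin m → ℂ} (hz : z ∈ polydisc m) :
    hardyEigenvector z ∈
      jointKernel (fun i : Fin m => ContinuousLinearMap.adjoint (hardyShift i)) z := by
  rw [mem_jointKernel_hardyShift]
  intro i I
  rw [hardyEigenvector_apply hz, hardyEigenvector_apply hz]
  simp only [Pi.add_apply, pow_add, Finset.prod_mul_distrib]
  rw [mul_comm]
  congr 1
  rw [Finset.prod_eq_single i (fun j _ hj => by simp [hj]) (by simp)]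
  simp

/-- The eigenvalue equations are the recursion x(I + e_i) = z_i x(I), which determines every
coefficient from x(0) by induction on the total degree. -/
theorem eq_smul_hardyEigenvector {z : Fin m → ℂ} (hz : z ∈ polydisc m) {x : HardySpace m}
    (hx : x ∈ jointKernel (fun i : Fin m => ContinuousLinearMap.adjoint (hardyShift i)) z) :
    x = x 0 • hardyEigenvector z := by
  rw [mem_jointKernel_hardyShift] at hx
  have key : ∀ (n : ℕ) (I : Fin m → ℕ), ∑ i, I i = n → x I = x 0 * ∏ i, z i ^ I i := by
    intro n
    induction n with
    | zero =>
      intro I hI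
      have : I = 0 := by
        ext i
        exact (Finset.sum_eq_zero_iff.1 hI) i (Finset.mem_univ i)
      simp [this]
    | succ n ih =>
      intro I hI
      obtain ⟨i, -, hi⟩ : ∃ i ∈ Finset.univ, I i ≠ 0 := by
        by_contra! h
        rw [Finset.sum_eq_zero h] at hI
        omega
      obtain ⟨J, rfl⟩ : ∃ J : Fin m → ℕ, I = J + Pi.single i 1 := by
        refine ⟨I - Pi.single i 1, ?_⟩
        ext k
        rcases eq_or_ne k i with rfl | hk
        · simp; omega
        · simp [hk]
      have hJ : ∑ i, J i = n := by
        simp only [Pi.add_apply, Finset.sum_add_distrib, Finset.sum_pi_single', Finset.mem_univ,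
          if_true] at hI
        simpa using hI
      have h1 : ∏ k, z k ^ (J + Pi.single i 1 : Fin m → ℕ) k = (∏ k, z k ^ J k) * z i := by
        simp only [Pi.add_apply, pow_add, Finset.prod_mul_distrib]
        congr 1
        rw [Finset.prod_eq_single i (fun j _ hj => by simp [hj]) (by simp)]
        simp
      rw [hx, ih J hJ, h1]
      ring
  refine lp.ext (funext fun I => ?_)
  rw [lp.coeFn_smul, Pi.smul_apply, hardyEigenvector_apply hz, smul_eq_mul]
  exact key _ I rfl

theorem span_monomial_topologicalClosure :
    (Submodule.span ℂ (range (monomial (m := m)))).topologicalClosure = ⊤ := by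
  rw [Submodule.topologicalClosure_eq_top_iff, Submodule.eq_bot_iff]
  intro x hx
  refine lp.ext (funext fun I => ?_)
  rw [← inner_monomial]
  exact (Submodule.mem_orthogonal _ x).1 hx _ (Submodule.subset_span (mem_range_self I))

/-- Weak holomorphy needs to be checked on a spanning set only. -/
theorem differentiableOn_inner_of_mem_span {H : Type*} [NormedAddCommGroup H]
    [InnerProductSpace ℂ H] {s : Set H} {Γ : (Fin m → ℂ) → H} {U : Set (Fin m → ℂ)}
    (h : ∀ f ∈ s, DifferentiableOn ℂ (fun x => inner ℂ f (Γ x)) U) :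
    ∀ f ∈ Submodule.span ℂ s, DifferentiableOn ℂ (fun x => inner ℂ f (Γ x)) U := by
  intro f hf
  induction hf using Submodule.span_induction with
  | mem f hf => exact h f hf
  | zero => simp
  | add f g _ _ hf hg =>
    simp only [inner_add_left]
    exact hf.add hg
  | smul c f _ hf =>
    simp only [inner_smul_left]
    exact hf.const_mul _

theorem isLocalSection_hardyEigenvector {w : Fin m → ℂ} (hw : w ∈ polydisc m) :
    IsLocalSection (fun i : Fin m => ContinuousLinearMap.adjoint (hardyShift i)) w
      hardyEigenvector := by
  refine ⟨polydisc m, isOpen_polydisc, hw, ?_, fun z hz => ⟨fun h0 => ?_, hardyEigenvector_mem hz⟩⟩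
  · refine differentiableOn_of_inner span_monomial_topologicalClosure isOpen_polydisc ?_
      (differentiableOn_inner_of_mem_span ?_)
    · refine ContinuousOn.congr (f := fun z : Fin m → ℂ => ∏ i, (1 - ‖z i‖ ^ 2)⁻¹) ?_
        fun z hz => norm_hardyEigenvector_sq hz
      refine continuousOn_finsetProd _ fun i _ => ContinuousOn.inv₀ (by fun_prop) fun z hz => ?_
      exact (sub_pos.2 (pow_lt_one₀ (norm_nonneg _) (hz i) two_ne_zero)).ne'
    · rintro _ ⟨I, rfl⟩
      refine DifferentiableOn.congr (f := fun z : Fin m → ℂ => ∏ i, z i ^ I i) ?_ fun z hz => by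
        rw [inner_monomial, hardyEigenvector_apply hz]
      exact Differentiable.differentiableOn (by fun_prop)
  · have := hardyEigenvector_apply hz 0
    rw [h0] at this
    simp at this

theorem one_sub_mul_ne_zero {p : (Fin m → ℂ) × (Fin m → ℂ)} (hp : p ∈ ball 0 1) (i : Fin m) :
    1 - p.1 i * p.2 i ≠ 0 := by
  have hp' := mem_ball_one_iff.1 hp
  have h1 : ‖p.1 i‖ < 1 := hp'.1 i
  have h2 : ‖p.2 i‖ < 1 := by simpa using hp'.2 i
  intro h
  have h3 : ‖p.1 i * p.2 i‖ = 1 := by rw [← sub_eq_zero.1 h, norm_one]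
  rw [norm_mul] at h3
  nlinarith [norm_nonneg (p.1 i), norm_nonneg (p.2 i)]

theorem differentiableOn_szegoKernel :
    DifferentiableOn ℂ (fun p : (Fin m → ℂ) × (Fin m → ℂ) => szegoKernel p.1 (star p.2))
      (ball 0 1) := by
  simp only [szegoKernel, Pi.star_apply, star_star]
  simp only [Finset.prod_inv_distrib]
  intro p hp
  refine ((differentiableAt_inv (Finset.prod_ne_zero_iff.2 fun i _ =>
    one_sub_mul_ne_zero hp i)).comp p ?_).differentiableWithinAt
  fun_prop

theorem szegoKernel_ne_zero {z w : Fin m → ℂ} (hz : z ∈ polydisc m) (hw : w ∈ polydisc m) :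
    szegoKernel z w ≠ 0 := by
  refine Finset.prod_ne_zero_iff.2 fun i _ => inv_ne_zero ?_
  have := one_sub_mul_ne_zero (p := (z, star w)) (mem_ball_one_iff.2 ⟨hz, by simpa using hw⟩) i
  simpa using this

theorem szegoKernel_self (z : Fin m → ℂ) :
    szegoKernel z z = ((∏ i, (1 - ‖z i‖ ^ 2)⁻¹ : ℝ) : ℂ) := by
  simp only [szegoKernel, Complex.ofReal_prod]
  refine Finset.prod_congr rfl fun i _ => ?_
  rw [Complex.star_def, Complex.mul_conj, Complex.normSq_eq_norm_sq]
  push_cast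
  rfl

theorem curvatureMatrix_hardyShift {w : Fin m → ℂ} (hw : w ∈ polydisc m) (i j : Fin m) :
    curvatureMatrix (fun i : Fin m => ContinuousLinearMap.adjoint (hardyShift i)) w i j =
      -mixedLog i j (fun p => szegoKernel p.1 (star p.2)) (w, star w) := by
  refine curvatureMatrix_apply (isLocalSection_hardyEigenvector hw) ?_ isOpen_ball
    differentiableOn_szegoKernel (mem_ball_one_iff.2 ⟨hw, by simpa using hw⟩) ?_ i j
  · filter_upwards [isOpen_polydisc.mem_nhds hw] with z hz x hx
    exact ⟨x 0, eq_smul_hardyEigenvector hz hx⟩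
  · filter_upwards [isOpen_polydisc.mem_nhds hw] with z hz
    simp only [star_star]
    rw [szegoKernel_self, norm_hardyEigenvector_sq hz]

end Hardy

theorem differentiableOn_comp_swap {m : ℕ} {f : (Fin m → ℂ) × (Fin m → ℂ) → ℂ}
    {U : Set ((Fin m → ℂ) × (Fin m → ℂ))} (hf : DifferentiableOn ℂ f U) :
    DifferentiableOn ℂ (fun p => f p.swap) (Prod.swap ⁻¹' U) := by
  have h : Differentiable ℂ (Prod.swap : (Fin m → ℂ) × (Fin m → ℂ) → _) :=
    differentiable_snd.prodMk differentiable_fst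
  exact DifferentiableOn.comp hf h.differentiableOn fun p hp => hp

/-! ### Multiplication operators, kernel vectors and their curvature. -/

section Multiplication

variable {m : ℕ} {H : Type*} [NormedAddCommGroup H] [InnerProductSpace ℂ H] [CompleteSpace H]
  [RKHS ℂ H (polydisc m) ℂ] {K : (Fin m → ℂ) → (Fin m → ℂ) → ℂ} {M : Fin m → H →L[ℂ] H}

theorem adjoint_kerFun (hM : IsMultiplicationTuple M) (i : Fin m) (w : polydisc m) (v : ℂ) :
    ContinuousLinearMap.adjoint (M i) (RKHS.kerFun H w v) = star (w.1 i) • RKHS.kerFun H w v := by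
  refine ext_inner_right ℂ fun f => ?_
  rw [ContinuousLinearMap.adjoint_inner_left, RKHS.kerFun_inner, hM i f w, inner_smul_left,
    RKHS.kerFun_inner]
  simp
  ring

theorem inner_kerFun_kerFun (hK : ∀ z w : polydisc m, RKHS.kernel H z w 1 = K z w)
    (z w : polydisc m) : inner ℂ (RKHS.kerFun H z (1 : ℂ)) (RKHS.kerFun H w (1 : ℂ)) = K z w := by
  rw [RKHS.kerFun_inner, RKHS.kerFun_apply, hK]
  simp

theorem kernel_star (hK : ∀ z w : polydisc m, RKHS.kernel H z w 1 = K z w)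
    {z w : Fin m → ℂ} (hz : z ∈ polydisc m) (hw : w ∈ polydisc m) : K w z = star (K z w) := by
  have h1 := inner_kerFun_kerFun (H := H) hK ⟨z, hz⟩ ⟨w, hw⟩
  have h2 := inner_kerFun_kerFun (H := H) hK ⟨w, hw⟩ ⟨z, hz⟩
  simp only at h1 h2
  rw [← h1, ← h2]
  exact (inner_conj_symm _ _).symm

theorem kernel_self_pos (hK : ∀ z w : polydisc m, RKHS.kernel H z w 1 = K z w)
    (hK0 : ∀ w ∈ polydisc m, K w w ≠ 0) {w : Fin m → ℂ} (hw : w ∈ polydisc m) : 0 < K w w := by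
  have h1 := inner_kerFun_kerFun (H := H) hK ⟨w, hw⟩ ⟨w, hw⟩
  simp only at h1
  refine lt_of_le_of_ne ?_ (hK0 w hw).symm
  have h2 : K w w = ((‖RKHS.kerFun H ⟨w, hw⟩ (1 : ℂ)‖ ^ 2 : ℝ) : ℂ) := by
    push_cast
    exact h1.symm.trans (inner_self_eq_norm_sq_to_K (𝕜 := ℂ) _)
  rw [h2, Complex.zero_le_real]
  positivity

/-- A multiplication operator is a contraction if `(1 - z_i conj w_i) K` is positive definite. -/
theorem norm_le_one_of_isPosDefKernelOn (hK : ∀ z w : polydisc m, RKHS.kernel H z w 1 = K z w)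
    (hM : IsMultiplicationTuple M) {i : Fin m}
    (h : IsPosDefKernelOn (polydisc m) fun z w => (1 - z i * star (w i)) * K z w) :
    ‖M i‖ ≤ 1 := by
  rw [← LinearIsometryEquiv.norm_map ContinuousLinearMap.adjoint (M i)]
  set A := ContinuousLinearMap.adjoint (M i) with hA
  refine ContinuousLinearMap.opNorm_le_bound _ zero_le_one fun f => ?_
  rw [one_mul]
  -- The inequality is closed, so finite combinations of kernel vectors suffice. There ‖f‖² - ‖Af‖²
  -- is exactly the form of (1 - z_i w̄_i) K.
  have hcl : IsClosed {f : H | ‖A f‖ ≤ ‖f‖} := isClosed_le (by fun_prop) (by fun_prop)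
  have hf : f ∈ closure (Submodule.span ℂ {RKHS.kerFun H x v | (x : polydisc m) (v : ℂ)} : Set H) := by
    rw [← Submodule.topologicalClosure_coe, RKHS.kerFun_dense]
    trivial
  refine hcl.closure_subset_iff.2 (fun f hf => ?_) hf
  obtain ⟨n, c, g, rfl⟩ := Submodule.mem_span_set'.1 hf
  have hg : ∀ a, ∃ (u : polydisc m) (v : ℂ), RKHS.kerFun H u v = g a := fun a => (g a).2
  choose u v huv using hg
  have hv : ∀ a, (g a : H) = v a • RKHS.kerFun H (u a) (1 : ℂ) := fun a => by
    rw [← huv a, ← map_smul]; simp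
  set x : Fin n → ℂ := fun a => c a * v a with hx
  have hsum : ∑ a, c a • (g a : H) = ∑ a, x a • RKHS.kerFun H (u a) (1 : ℂ) :=
    Finset.sum_congr rfl fun a _ => by rw [hv, smul_smul]
  have hAsum : A (∑ a, c a • (g a : H)) =
      ∑ a, (x a * star ((u a).1 i)) • RKHS.kerFun H (u a) (1 : ℂ) := by
    rw [hsum, map_sum]
    refine Finset.sum_congr rfl fun a _ => ?_
    rw [map_smul, hA, adjoint_kerFun hM, smul_smul]
  have hinner : ∀ y : Fin n → ℂ, ((‖∑ a, y a • RKHS.kerFun H (u a) (1 : ℂ)‖ ^ 2 : ℝ) : ℂ) =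
      ∑ a, ∑ b, star (y a) * K (u a) (u b) * y b := by
    intro y
    have := inner_self_eq_norm_sq_to_K (𝕜 := ℂ) (∑ a, y a • RKHS.kerFun H (u a) (1 : ℂ))
    push_cast
    refine this.symm.trans ?_
    rw [sum_inner]
    refine Finset.sum_congr rfl fun a _ => ?_
    rw [inner_sum]
    refine Finset.sum_congr rfl fun b _ => ?_
    rw [inner_smul_left, inner_smul_right, inner_kerFun_kerFun hK, Complex.star_def]
    ring
  have hpos := posSemidef_iff_sum_nonneg.1 (h n (fun a => u a) fun a => (u a).2) x
  have hdiff : ((‖∑ a, c a • (g a : H)‖ ^ 2 - ‖A (∑ a, c a • (g a : H))‖ ^ 2 : ℝ) : ℂ) =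
      ∑ a, ∑ b, star (x a) * (Matrix.of fun a b => (1 - (u a).1 i * star ((u b).1 i)) *
        K (u a) (u b)) a b * x b := by
    rw [Complex.ofReal_sub, hAsum, hinner, hsum, hinner, ← Finset.sum_sub_distrib]
    refine Finset.sum_congr rfl fun a _ => ?_
    rw [← Finset.sum_sub_distrib]
    refine Finset.sum_congr rfl fun b _ => ?_
    simp only [Matrix.of_apply, star_mul', star_star]
    ring
  rw [← hdiff, Complex.zero_le_real, sub_nonneg] at hpos
  exact (sq_le_sq₀ (norm_nonneg _) (norm_nonneg _)).1 hpos

open Classical in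
/-- The reproducing kernel vector at `conj z`, a holomorphic function of `z`. -/
def kernelVector (H : Type*) [NormedAddCommGroup H] [InnerProductSpace ℂ H] [CompleteSpace H]
    [RKHS ℂ H (polydisc m) ℂ] (z : Fin m → ℂ) : H :=
  if hz : star z ∈ polydisc m then RKHS.kerFun H ⟨star z, hz⟩ (1 : ℂ) else 0

theorem kernelVector_eq {z : Fin m → ℂ} (hz : z ∈ polydisc m) :
    kernelVector H z = RKHS.kerFun H ⟨star z, star_mem_polydisc.2 hz⟩ (1 : ℂ) :=
  dif_pos (star_mem_polydisc.2 hz)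

theorem norm_kernelVector_sq (hK : ∀ z w : polydisc m, RKHS.kernel H z w 1 = K z w)
    {z : Fin m → ℂ} (hz : z ∈ polydisc m) :
    ((‖kernelVector H z‖ ^ 2 : ℝ) : ℂ) = K (star z) (star z) := by
  have h1 := inner_kerFun_kerFun (H := H) hK ⟨star z, star_mem_polydisc.2 hz⟩
    ⟨star z, star_mem_polydisc.2 hz⟩
  rw [kernelVector_eq hz]
  push_cast
  exact (inner_self_eq_norm_sq_to_K (𝕜 := ℂ) _).symm.trans h1

theorem kernelVector_mem (hM : IsMultiplicationTuple M) {z : Fin m → ℂ} (hz : z ∈ polydisc m) :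
    kernelVector H z ∈ jointKernel (fun i => ContinuousLinearMap.adjoint (M i)) z := by
  rw [mem_jointKernel, kernelVector_eq hz]
  intro i
  rw [adjoint_kerFun hM]
  simp

theorem kernelVector_ne_zero (hK : ∀ z w : polydisc m, RKHS.kernel H z w 1 = K z w)
    (hK0 : ∀ w ∈ polydisc m, K w w ≠ 0) {z : Fin m → ℂ} (hz : z ∈ polydisc m) :
    kernelVector H z ≠ 0 := by
  intro h0
  have := norm_kernelVector_sq (H := H) hK hz
  rw [h0] at this
  exact hK0 _ (star_mem_polydisc.2 hz) (by simpa using this.symm)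

theorem isLocalSection_kernelVector (hKd : IsSesquiholomorphicOn (polydisc m) K)
    (hK : ∀ z w : polydisc m, RKHS.kernel H z w 1 = K z w)
    (hK0 : ∀ w ∈ polydisc m, K w w ≠ 0) (hM : IsMultiplicationTuple M) {w : Fin m → ℂ}
    (hw : w ∈ polydisc m) :
    IsLocalSection (fun i => ContinuousLinearMap.adjoint (M i)) w (kernelVector H) := by
  rw [isSesquiholomorphicOn_polydisc] at hKd
  refine ⟨polydisc m, isOpen_polydisc, hw, ?_, fun z hz =>
    ⟨kernelVector_ne_zero hK hK0 hz, kernelVector_mem hM hz⟩⟩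
  refine differentiableOn_of_inner (RKHS.kerFun_dense H) isOpen_polydisc ?_
    (differentiableOn_inner_of_mem_span ?_)
  · have hc : Continuous fun z : Fin m → ℂ => (star z, z) := by fun_prop
    have h1 : ContinuousOn (fun z : Fin m → ℂ => (K (star z) (star z)).re) (polydisc m) :=
      Complex.continuous_re.comp_continuousOn (hKd.continuousOn.comp hc.continuousOn fun z hz =>
        mem_ball_one_iff.2 ⟨star_mem_polydisc.2 hz, star_mem_polydisc.2 hz⟩)
    refine h1.congr fun z hz => ?_
    simp only
    rw [← norm_kernelVector_sq hK hz, Complex.ofReal_re]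
  · rintro _ ⟨a, v, rfl⟩
    have h1 : DifferentiableOn ℂ (fun z : Fin m → ℂ => K a (star z)) (polydisc m) :=
      hKd.comp (f := fun z : Fin m → ℂ => (a.1, z)) (Differentiable.differentiableOn (by fun_prop))
        fun z hz => mem_ball_one_iff.2 ⟨a.2, star_mem_polydisc.2 hz⟩
    refine (h1.mul_const (star v)).congr fun z hz => ?_
    rw [kernelVector_eq hz, RKHS.kerFun_inner, RKHS.kerFun_apply, hK]
    simp

/-- The joint kernels are one-dimensional by the Cowen–Douglas condition, so the nonzero kernel
vector spans. -/
theorem eq_smul_kernelVector (hK : ∀ z w : polydisc m, RKHS.kernel H z w 1 = K z w)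
    (hK0 : ∀ w ∈ polydisc m, K w w ≠ 0) (hM : IsMultiplicationTuple M)
    (hB : IsCowenDouglas 1 (polydisc m) fun i => ContinuousLinearMap.adjoint (M i))
    {z : Fin m → ℂ} (hz : z ∈ polydisc m) {x : H}
    (hx : x ∈ jointKernel (fun i => ContinuousLinearMap.adjoint (M i)) z) :
    ∃ c : ℂ, x = c • kernelVector H z := by
  have h1 := hB.rank_jointKernel z hz
  rw [Nat.cast_one, Module.rank_eq_one_iff_finrank_eq_one] at h1
  obtain ⟨c, hc⟩ := (finrank_eq_one_iff_of_nonzero' ⟨kernelVector H z, kernelVector_mem hM hz⟩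
    (by simpa [Subtype.ext_iff] using kernelVector_ne_zero hK hK0 hz)).1 h1 ⟨x, hx⟩
  exact ⟨c, by simpa using (congrArg Subtype.val hc).symm⟩

/-- The swap comes from conjugation: ‖γ(w)‖² = K(w̄, w̄), and its polarization is K(v, z̄). -/
theorem curvatureMatrix_adjoint (hKd : IsSesquiholomorphicOn (polydisc m) K)
    (hK : ∀ z w : polydisc m, RKHS.kernel H z w 1 = K z w)
    (hK0 : ∀ w ∈ polydisc m, K w w ≠ 0) (hM : IsMultiplicationTuple M)
    (hB : IsCowenDouglas 1 (polydisc m) fun i => ContinuousLinearMap.adjoint (M i))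
    {w : Fin m → ℂ} (hw : w ∈ polydisc m) (i j : Fin m) :
    curvatureMatrix (fun i => ContinuousLinearMap.adjoint (M i)) w i j =
      -mixedLog i j (fun p => K p.swap.1 (star p.swap.2)) (w, star w) := by
  refine curvatureMatrix_apply (isLocalSection_kernelVector hKd hK hK0 hM hw) ?_ isOpen_ball
    (U := ball 0 1) ?_ (mem_ball_one_iff.2 ⟨hw, by simpa using hw⟩) ?_ i j
  · filter_upwards [isOpen_polydisc.mem_nhds hw] with z hz x hx
    exact eq_smul_kernelVector hK hK0 hM hB hz hx
  · refine (isSesquiholomorphicOn_polydisc.1 hKd).comp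
      (ContinuousLinearEquiv.prodComm ℂ (Fin m → ℂ) (Fin m → ℂ)).differentiable.differentiableOn
      fun p hp => ?_
    exact mk_mem_ball_iff.2 (mk_mem_ball_iff.1 hp).symm
  · filter_upwards [isOpen_polydisc.mem_nhds hw] with z hz
    exact (norm_kernelVector_sq hK hz).symm

end Multiplication

/-! ### The equivalences. -/

section Main

variable {m : ℕ}

theorem IsPositiveDefiniteFunction.congr {Ω : Set (Fin m → ℂ)}
    {G G' : (Fin m → ℂ) → Matrix (Fin m) (Fin m) ℂ} (hG : IsPositiveDefiniteFunction Ω G)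
    (h : ∀ w ∈ Ω, G w = G' w) : IsPositiveDefiniteFunction Ω G' := by
  obtain ⟨F, hF, hFG, hpos⟩ := hG
  exact ⟨F, hF, fun w hw => (hFG w hw).trans (h w hw), hpos⟩

/-- The polarization F(w̄, z̄)ᵀ is again holomorphic in z, and its block matrices are transposes of
those of F at the conjugate points. -/
theorem IsPositiveDefiniteFunction.transpose_star {G : (Fin m → ℂ) → Matrix (Fin m) (Fin m) ℂ}
    (hG : IsPositiveDefiniteFunction (polydisc m) G) :
    IsPositiveDefiniteFunction (polydisc m) fun w => (G (star w)).transpose := by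
  obtain ⟨F, hF, hFG, hpos⟩ := hG
  refine ⟨fun z w => (F (star w) (star z)).transpose, fun i j => ?_, fun w hw => ?_,
    fun n u hu => ?_⟩
  · have := isSesquiholomorphicOn_polydisc.1 (hF j i)
    rw [isSesquiholomorphicOn_polydisc]
    simp only [star_star, Matrix.transpose_apply]
    exact this.comp
      (ContinuousLinearEquiv.prodComm ℂ (Fin m → ℂ) (Fin m → ℂ)).differentiable.differentiableOn
      fun p hp => mk_mem_ball_iff.2 (mk_mem_ball_iff.1 hp).symm
  · simp only
    rw [hFG _ (star_mem_polydisc.2 hw)]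
  · have := (hpos n (fun a => star (u a)) fun a => star_mem_polydisc.2 (hu a)).transpose
    exact this

/-- The quotient `K / S` of a kernel by the Szegő kernel, as a function of `(z, conj w)`. -/
def quotientKernel (K : (Fin m → ℂ) → (Fin m → ℂ) → ℂ) (p : (Fin m → ℂ) × (Fin m → ℂ)) : ℂ :=
  (szegoKernel p.1 (star p.2))⁻¹ * K p.1 (star p.2)

variable {K : (Fin m → ℂ) → (Fin m → ℂ) → ℂ}

theorem differentiableOn_quotientKernel (hKd : IsSesquiholomorphicOn (polydisc m) K) :
    DifferentiableOn ℂ (quotientKernel K) (ball 0 1) := by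
  have h1 := differentiableOn_div (isSesquiholomorphicOn_polydisc.1 hKd)
    (differentiableOn_szegoKernel (m := m)) fun p hp =>
      szegoKernel_ne_zero (mem_ball_one_iff.1 hp).1 (mem_ball_one_iff.1 hp).2
  refine h1.congr fun p _ => ?_
  rw [quotientKernel, div_eq_inv_mul]

theorem quotientKernel_self_pos (hKpos : ∀ w ∈ polydisc m, 0 < K w w) {w : Fin m → ℂ}
    (hw : w ∈ polydisc m) : 0 < quotientKernel K (w, star w) := by
  simp only [quotientKernel, star_star]
  refine mul_pos ?_ (hKpos w hw)
  rw [szegoKernel_self, ← Complex.ofReal_inv, Complex.zero_lt_real, inv_pos]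
  exact Finset.prod_pos fun i _ => inv_pos.2
    (sub_pos.2 (pow_lt_one₀ (norm_nonneg _) (hw i) two_ne_zero))

theorem complexHessian_log_quotientKernel (hKd : IsSesquiholomorphicOn (polydisc m) K)
    (hKpos : ∀ w ∈ polydisc m, 0 < K w w) {w : Fin m → ℂ} (hw : w ∈ polydisc m) (i j : Fin m) :
    complexHessian (fun w => Real.log ((szegoKernel w w)⁻¹ * K w w).re) w i j =
      mixedLog i j (quotientKernel K) (w, star w) := by
  refine complexHessian_eq_mixedLog isOpen_ball (differentiableOn_quotientKernel hKd)
    (mem_ball_one_iff.2 ⟨hw, by simpa using hw⟩) ?_ i j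
  filter_upwards [isOpen_polydisc.mem_nhds hw] with z hz
  refine ⟨quotientKernel_self_pos hKpos hz, ?_⟩
  simp [quotientKernel]

theorem szegoKernel_symm (z v : Fin m → ℂ) : szegoKernel z (star v) = szegoKernel v (star z) := by
  simp [szegoKernel, mul_comm]

/-- The difference of the curvatures is the transpose, at the conjugate point, of the Hessian of
the logarithm of the quotient kernel. -/
theorem mixedLog_szegoKernel_sub (hKd : IsSesquiholomorphicOn (polydisc m) K)
    (hKpos : ∀ w ∈ polydisc m, 0 < K w w) {w : Fin m → ℂ} (hw : w ∈ polydisc m) (i j : Fin m) :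
    -mixedLog i j (fun p => szegoKernel p.1 (star p.2)) (w, star w) -
        -mixedLog i j (fun p => K p.swap.1 (star p.swap.2)) (w, star w) =
      mixedLog j i (quotientKernel K) (star w, w) := by
  have hQ := differentiableOn_quotientKernel hKd
  set U := ball (0 : (Fin m → ℂ) × (Fin m → ℂ)) 1 ∩ quotientKernel K ⁻¹' {0}ᶜ with hU
  have hUo : IsOpen U := hQ.continuousOn.isOpen_inter_preimage isOpen_ball isOpen_compl_singleton
  have hwU : (star w, w) ∈ U := by
    refine ⟨mem_ball_one_iff.2 ⟨star_mem_polydisc.2 hw, star_mem_polydisc.2 hw⟩, ?_⟩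
    have := (quotientKernel_self_pos hKpos (star_mem_polydisc.2 hw)).ne'
    rwa [star_star] at this
  set V := Prod.swap ⁻¹' U with hV
  have hVo : IsOpen V := hUo.preimage continuous_swap
  have hVb : V ⊆ ball 0 1 := fun p hp => mk_mem_ball_iff.2 (mk_mem_ball_iff.1 hp.1).symm
  have hQU : DifferentiableOn ℂ (quotientKernel K) U := hQ.mono inter_subset_left
  have hQ0 : ∀ p ∈ U, quotientKernel K p ≠ 0 := fun p hp => hp.2
  have hQs := differentiableOn_comp_swap hQU
  have hwV : (w, star w) ∈ V := hwU
  have hS0 : ∀ p ∈ V, szegoKernel p.1 (star p.2) ≠ 0 := fun p hp =>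
    szegoKernel_ne_zero (mem_ball_one_iff.1 (hVb hp)).1 (mem_ball_one_iff.1 (hVb hp)).2
  have h1 : (fun p : (Fin m → ℂ) × (Fin m → ℂ) => K p.swap.1 (star p.swap.2)) =ᶠ[𝓝 (w, star w)]
      fun p => szegoKernel p.1 (star p.2) * quotientKernel K p.swap := by
    filter_upwards [hVo.mem_nhds hwV] with p hp
    have := hS0 p hp
    rw [quotientKernel, Prod.fst_swap, Prod.snd_swap, szegoKernel_symm p.2 p.1,
      mul_inv_cancel_left₀ this]
  have h2 := mixedLog_mul (Q := fun p => szegoKernel p.1 (star p.2))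
    (R := fun p => quotientKernel K p.swap) hVo (differentiableOn_szegoKernel.mono hVb) hQs hS0
    (fun p hp => hQ0 _ hp) hwV i j
  have h3 := mixedLog_comp_swap hUo hQU hQ0 hwU i j
  rw [mixedLog_congr h1, h2, h3]
  ring

/-- Multiplying S⁻¹K by the Szegő factors of the other variables cancels everything in S⁻¹ except 1
- z_i w̄_i, and the Schur product keeps positivity. -/
theorem isPosDefKernelOn_szego_mul (hQ : IsPosDefKernelOn (polydisc m) fun z w =>
      (szegoKernel z w)⁻¹ * K z w) (i : Fin m) :
    IsPosDefKernelOn (polydisc m) fun z w => (1 - z i * star (w i)) * K z w := by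
  refine ((isPosDefKernelOn_prod (Finset.univ.erase i)
    fun j _ => isPosDefKernelOn_geometric j).mul hQ).congr fun z hz w hw => ?_
  have h1 : szegoKernel z w = (1 - z i * star (w i))⁻¹ *
      ∏ j ∈ Finset.univ.erase i, (1 - z j * star (w j))⁻¹ :=
    (Finset.mul_prod_erase _ _ (Finset.mem_univ i)).symm
  have h2 := szegoKernel_ne_zero hz hw
  rw [h1] at h2 ⊢
  obtain ⟨h3, h4⟩ := mul_ne_zero_iff.1 h2
  rw [mul_inv, inv_inv]
  generalize ∏ j ∈ Finset.univ.erase i, (1 - z j * star (w j))⁻¹ = P at h4 ⊢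
  rw [mul_comm _ P⁻¹, mul_assoc, mul_inv_cancel_left₀ h4]

theorem isPositiveDefiniteFunction_iff {H : Type*} [NormedAddCommGroup H] [InnerProductSpace ℂ H]
    [CompleteSpace H] [RKHS ℂ H (polydisc m) ℂ] {M : Fin m → H →L[ℂ] H}
    (hKd : IsSesquiholomorphicOn (polydisc m) K) (hK0 : ∀ w ∈ polydisc m, K w w ≠ 0)
    (hK : ∀ z w : polydisc m, RKHS.kernel H z w 1 = K z w) (hM : IsMultiplicationTuple M) :
    IsPositiveDefiniteFunction (polydisc m)
        (complexHessian fun w => Real.log ((szegoKernel w w)⁻¹ * K w w).re) ↔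
      IsInfinitelyDivisibleTupleOfContractions K M := by
  have hKpos : ∀ w ∈ polydisc m, 0 < K w w := fun w hw => kernel_self_pos (H := H) hK hK0 hw
  constructor
  · rintro ⟨F, hF, hFG, hpos⟩
    have hdiv : IsInfinitelyDivisibleOn (polydisc m) fun z w => (szegoKernel z w)⁻¹ * K z w := by
      have := isInfinitelyDivisibleOn_of_mixedLog (Q := quotientKernel K)
        (differentiableOn_quotientKernel hKd) (fun w hw => quotientKernel_self_pos hKpos hw) ?_ hF
        (fun w hw i j => by
          rw [hFG w hw, complexHessian_log_quotientKernel hKd hKpos hw]) hpos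
      · simpa [quotientKernel] using this
      · intro v hv
        have h0 : (0 : Fin m → ℂ) ∈ polydisc m := by simp [polydisc]
        simp [quotientKernel, szegoKernel, kernel_star (H := H) hK hv h0]
    refine ⟨fun i => norm_le_one_of_isPosDefKernelOn hK hM (isPosDefKernelOn_szego_mul ?_ i), hdiv⟩
    -- Contractivity needs only the power t = 1, that is, positivity of S⁻¹K itself.
    obtain ⟨L, -, hLe, -, hL⟩ := hdiv
    refine (hL 1 one_pos).congr fun z hz w hw => ?_
    simpa using hLe z hz w hw
  · rintro ⟨-, hdiv⟩
    exact isPositiveDefiniteFunction_of_isInfinitelyDivisibleOn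
      (F := fun z w => (szegoKernel z w)⁻¹ * K z w) hdiv

/-- The difference of the curvatures is G(w̄)ᵀ. Since G ↦ G(w̄)ᵀ is an involution, `transpose_star`
gives both directions. -/
theorem precOn_curvatureMatrix_iff {H : Type*} [NormedAddCommGroup H] [InnerProductSpace ℂ H]
    [CompleteSpace H] [RKHS ℂ H (polydisc m) ℂ] {M : Fin m → H →L[ℂ] H}
    (hKd : IsSesquiholomorphicOn (polydisc m) K) (hK0 : ∀ w ∈ polydisc m, K w w ≠ 0)
    (hK : ∀ z w : polydisc m, RKHS.kernel H z w 1 = K z w) (hM : IsMultiplicationTuple M)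
    (hB : IsCowenDouglas 1 (polydisc m) fun i => ContinuousLinearMap.adjoint (M i)) :
    PrecOn (polydisc m) (curvatureMatrix fun i => ContinuousLinearMap.adjoint (M i))
        (curvatureMatrix fun i : Fin m => ContinuousLinearMap.adjoint (hardyShift i)) ↔
      IsPositiveDefiniteFunction (polydisc m)
        (complexHessian fun w => Real.log ((szegoKernel w w)⁻¹ * K w w).re) := by
  have hKpos : ∀ w ∈ polydisc m, 0 < K w w := fun w hw => kernel_self_pos (H := H) hK hK0 hw
  set G := complexHessian fun w => Real.log ((szegoKernel w w)⁻¹ * K w w).re with hG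
  have key : ∀ w ∈ polydisc m,
      curvatureMatrix (fun i : Fin m => ContinuousLinearMap.adjoint (hardyShift i)) w -
        curvatureMatrix (fun i => ContinuousLinearMap.adjoint (M i)) w =
      (G (star w)).transpose := by
    intro w hw
    ext i j
    rw [Matrix.sub_apply, curvatureMatrix_hardyShift hw, curvatureMatrix_adjoint hKd hK hK0 hM hB hw,
      mixedLog_szegoKernel_sub hKd hKpos hw, Matrix.transpose_apply, hG,
      complexHessian_log_quotientKernel hKd hKpos (star_mem_polydisc.2 hw), star_star]
  constructor
  · intro h
    refine (IsPositiveDefiniteFunction.congr h key).transpose_star.congr fun w _ => ?_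
    simp
  · intro h
    exact h.transpose_star.congr fun w hw => (key w hw).symm

end Main

end CowenDouglas

end

theorem mainTheorem6 {m : ℕ} {H : Type*} [NormedAddCommGroup H] [InnerProductSpace ℂ H]
    [CompleteSpace H] [RKHS ℂ H (CowenDouglas.polydisc m) ℂ]
    (K : (Fin m → ℂ) → (Fin m → ℂ) → ℂ)
    (hK_holo : CowenDouglas.IsSesquiholomorphicOn (CowenDouglas.polydisc m) K)
    (hK_ne : ∀ w ∈ CowenDouglas.polydisc m, K w w ≠ 0)
    (hK_kernel : ∀ z w : CowenDouglas.polydisc m, RKHS.kernel H z w 1 = K z w)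
    (M : Fin m → H →L[ℂ] H)
    (hM : CowenDouglas.IsMultiplicationTuple M)
    (hB : CowenDouglas.IsCowenDouglas 1 (CowenDouglas.polydisc m)
      fun i => ContinuousLinearMap.adjoint (M i)) :
    (CowenDouglas.IsPositiveDefiniteFunction (CowenDouglas.polydisc m)
        (CowenDouglas.complexHessian fun w =>
          Real.log ((CowenDouglas.szegoKernel w w)⁻¹ * K w w).re) ↔
      CowenDouglas.IsInfinitelyDivisibleTupleOfContractions K M) ∧
    (CowenDouglas.PrecOn (CowenDouglas.polydisc m)
        (CowenDouglas.curvatureMatrix fun i => ContinuousLinearMap.adjoint (M i))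
        (CowenDouglas.curvatureMatrix fun i : Fin m =>
          ContinuousLinearMap.adjoint (CowenDouglas.hardyShift i)) ↔
      CowenDouglas.IsInfinitelyDivisibleTupleOfContractions K M) := by
  have h := CowenDouglas.isPositiveDefiniteFunction_iff hK_holo hK_ne hK_kernel hM
  exact ⟨h, (CowenDouglas.precOn_curvatureMatrix_iff hK_holo hK_ne hK_kernel hM hB).trans h⟩
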